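/- Let $\Omega\subset\mathbb{R}^3$ be a bounded connected open set of class $C^1$ with outward unit normal $\mathbf n$ and surface measure $\sigma$ on $\partial\Omega$; let $T>0$, $\nu\ge 0$, and let $(X,\mathcal B,P)$ be a probability space. Write $\overline{\psi}(t,x)=\int_X\psi(t,x,\omega)\,dP(\omega)$ and $\psi'=\psi-\overline\psi$ for the mean and the fluctuation of a random field $\psi$, and let $\operatorname{curl}\mathbf u=\nabla\times\mathbf u$. For every $\omega\in X$ let $(\mathbf v,\pi)=(\mathbf v(t,x,\omega),\pi(t,x,\omega))$ be a classical solution of $$\mathbf v_t+\boldsymbol\omega\times\mathbf v-\nu\Delta\mathbf v+\nabla\big(\pi+\tfrac12|\mathbf v|^2\big)=\mathbf f,\qquad \boldsymbol\omega=\operatorname{curl}\mathbf v,\qquad \operatorname{div}\mathbf v=0\qquad\text{in }(0,T)\times\Omega,$$ with $\mathbf v=\mathbf 0$ on $(0,T)\times\partial\Omega$ and $\mathbf v(0)=\mathbf v_0$ in $\Omega$. Here "classical" means: $\mathbf v$ is differentiable in $t$, and for each $t\in(0,T)$ it is $C^2$ in $x\in\Omega$ and continuous on $\overline\Omega$; $\pi+\tfrac12|\mathbf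 v|^2$ is $C^1$ in $x\in\Omega$; and $\|\mathbf v(t)-\mathbf v_0\|_{L^2(\Omega)}\to0$ as $t\to0^+$. For $t\in(0,T)$ and $x\in\Omega$ let $\mathbf v(t,x,\cdot)$ and $\pi(t,x,\cdot)$ be measurable, and let $\mathbf v_0$ be jointly measurable in $(x,\omega)$. Assume the following bounds. * For every $[t_1,t_2]\subset(0,T)$ there are $M\in L^2(P)$ and an integrable continuous $g:\Omega\to\mathbb R$ such that, for all $t\in[t_1,t_2]$, $x\in\Omega$ and $\omega\in X$, $|\mathbf v|,|\nabla\mathbf v|\le M$, $|\nabla^2\mathbf v|\le M\,g$ and $|\mathbf v_t|,|\pi|,|\nabla\pi|\le M^2 g$, where $M=M(\omega)$ and $g=g(x)$. * For some $\delta>0$ and some $M_0\in L^2(P)$, $\|\mathbf v(t,\cdot,\omega)\|_{L^2(\Omega)}\le M_0(\omega)$ for all $0<t<\delta$ and $\omega\in X$. Then for $t\in(0,T)$ and $x\in\Omega$ the means of $\mathbf v$, $\boldsymbol\omega$, $\pi$, $\mathbf f$, $|\mathbf v'|^2$ and $\boldsymbol\omega'\times\mathbf v'$ exist, and $\overline{\boldsymbol\omega}=\operatorname{curl}\overline{\mathbf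 v}$. The turbulent stress $\mathbf s=\overline{\boldsymbol\omega'\times\mathbf v'}$ (whose value on $\partial\Omega$ is $\mathbf 0$, because $\mathbf v'=\mathbf 0$ there) is, for each $t\in(0,T)$, continuous on $\overline\Omega$ and $C^1$ in $\Omega$. There are a vector field $\mathbf a^{(R)}$ and a scalar potential $\Phi$, given for $(t,x)\in(0,T)\times\Omega$ by the absolutely convergent integrals $$\mathbf a^{(R)}(t,x)=\frac1{4\pi}\int_\Omega\frac{\operatorname{curl}\mathbf s(t,y)}{|x-y|}\,dy+\frac1{4\pi}\int_{\partial\Omega}\frac{\mathbf s(t,y)}{|x-y|}\times\mathbf n(y)\,d\sigma(y),$$ $$\Phi(t,x)=\frac1{4\pi}\int_\Omega\frac{\operatorname{div}\mathbf s(t,y)}{|x-y|}\,dy-\frac1{4\pi}\int_{\partial\Omega}\frac{\mathbf s(t,y)}{|x-y|}\cdot\mathbf n(y)\,d\sigma(y),$$ both $C^1$ in $x\in\Omega$ for each $t\in(0,T)$, such that, with the turbulent kinetic energy $k=\tfrac12\overline{|\mathbf v'|^2}$, $$\overline{\mathbf v}_t+\overline{\boldsymbol\omega}\times\overline{\mathbf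 v}+\operatorname{curl}\mathbf a^{(R)}-\nu\Delta\overline{\mathbf v}+\nabla\big(\overline\pi+\tfrac12|\overline{\mathbf v}|^2+k-\Phi\big)=\overline{\mathbf f},\qquad\operatorname{div}\overline{\mathbf v}=0\qquad\text{in }(0,T)\times\Omega,$$ with $\overline{\mathbf v}=\mathbf 0$ on $(0,T)\times\partial\Omega$ and $\overline{\mathbf v}(0)=\overline{\mathbf v_0}$ in $\Omega$. Moreover $(\overline{\mathbf v},\ \overline\pi+\tfrac12|\overline{\mathbf v}|^2+k-\Phi)$ has the regularity of a classical solution stated above, including $\|\overline{\mathbf v}(t)-\overline{\mathbf v_0}\|_{L^2(\Omega)}\to0$ as $t\to0^+$. -/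

import Mathlib

open MeasureTheory Set Filter Topology
open scoped ENNReal

namespace Reynolds

/-! ### Vector calculus in three dimensions -/

/-- Euclidean three-space. -/
abbrev E3 : Type := EuclideanSpace ℝ (Fin 3)

/-- The cross product of two vectors of Euclidean three-space. -/
noncomputable def cross (a b : E3) : E3 :=
  WithLp.toLp 2 (crossProduct a.ofLp b.ofLp)

/-- The partial derivative `∂u/∂xᵢ`. -/
noncomputable def partialD {F : Type*} [NormedAddCommGroup F] [NormedSpace ℝ F]
    (i : Fin 3) (u : E3 → F) (x : E3) : F :=
  fderiv ℝ u x (EuclideanSpace.single i 1)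

/-- The curl `∇ × u` (right-handed convention, `(curl u)₀ = ∂₁u₂ - ∂₂u₁` and cyclically). -/
noncomputable def curl (u : E3 → E3) (x : E3) : E3 :=
  !₂[partialD 1 u x 2 - partialD 2 u x 1,
     partialD 2 u x 0 - partialD 0 u x 2,
     partialD 0 u x 1 - partialD 1 u x 0]

/-- The divergence `∇ · u`. -/
noncomputable def div (u : E3 → E3) (x : E3) : ℝ := ∑ i, partialD i u x i

/-! ### Domains of class `C¹`, outward normal, surface measure -/

/-- `Ω` is an open set of class `C¹`: near each boundary point and after a rigid motion it is the
region below the graph of a `C¹` function of the first two coordinates. -/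
def IsOfClassC1 (Ω : Set E3) : Prop :=
  IsOpen Ω ∧ ∀ p ∈ frontier Ω, ∃ U ∈ 𝓝 p, ∃ e : E3 ≃ᵃⁱ[ℝ] E3, ∃ h : ℝ × ℝ → ℝ,
    ContDiff ℝ 1 h ∧ ∀ x ∈ U, x ∈ Ω ↔ (e x) 2 < h ((e x) 0, (e x) 1)

/-- `n` is the outward unit normal of `Ω` at `x`: the normalized gradient at `x` of a `C¹` function
`φ` such that `Ω = {φ < 0}` near `x`. -/
def IsOutwardUnitNormal (Ω : Set E3) (x n : E3) : Prop :=
  ‖n‖ = 1 ∧ ∃ φ : E3 → ℝ, ContDiffAt ℝ 1 φ x ∧ (∀ᶠ y in 𝓝 x, y ∈ Ω ↔ φ y < 0) ∧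
    ∃ c : ℝ, 0 < c ∧ gradient φ x = c • n

open Classical in
/-- The outward unit normal field on the boundary of `Ω`. -/
noncomputable def outwardNormal (Ω : Set E3) (x : E3) : E3 :=
  if h : ∃ n, IsOutwardUnitNormal Ω x n then h.choose else 0

/-- The surface measure on the boundary of `Ω`: the two-dimensional Hausdorff measure, normalized
to be area on planes. -/
noncomputable def surfaceMeasure (Ω : Set E3) : Measure E3 :=
  (Measure.euclideanHausdorffMeasure 2 : Measure E3).restrict (frontier Ω)

/-! ### Newtonian potentials of a vector field on a domain -/

/-- The vector potential
`(1/4π) ∫_Ω curl s(y) / |x - y| dy + (1/4π) ∫_∂Ω (s(y) / |x - y|) × n(y) dσ(y)`. -/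
noncomputable def vectorPotential (Ω : Set E3) (s : E3 → E3) (x : E3) : E3 :=
  (1 / (4 * Real.pi)) • (∫ y in Ω, (1 / ‖x - y‖) • curl s y) +
  (1 / (4 * Real.pi)) •
    ∫ y, cross ((1 / ‖x - y‖) • s y) (outwardNormal Ω y) ∂(surfaceMeasure Ω)

/-- The scalar potential
`(1/4π) ∫_Ω div s(y) / |x - y| dy - (1/4π) ∫_∂Ω (s(y) / |x - y|) · n(y) dσ(y)`. -/
noncomputable def scalarPotential (Ω : Set E3) (s : E3 → E3) (x : E3) : ℝ :=
  (1 / (4 * Real.pi)) * (∫ y in Ω, (1 / ‖x - y‖) * div s y) -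
  (1 / (4 * Real.pi)) *
    ∫ y, inner ℝ ((1 / ‖x - y‖) • s y) (outwardNormal Ω y) ∂(surfaceMeasure Ω)

/-- The four integrals in the definition of the two potentials at `x` converge absolutely. -/
def PotentialsConverge (Ω : Set E3) (s : E3 → E3) (x : E3) : Prop :=
  IntegrableOn (fun y => (1 / ‖x - y‖) • curl s y) Ω ∧
  Integrable (fun y => cross ((1 / ‖x - y‖) • s y) (outwardNormal Ω y)) (surfaceMeasure Ω) ∧
  IntegrableOn (fun y => (1 / ‖x - y‖) * div s y) Ω ∧
  Integrable (fun y => inner ℝ ((1 / ‖x - y‖) • s y) (outwardNormal Ω y)) (surfaceMeasure Ω)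

/-! ### The equations of motion in rotational form -/

/-- `(u, q)` is a classical solution on `(0, T) × Ω` of
`u_t + curl u × u + b - ν Δu + ∇q = f`, `div u = 0`, `u = 0` on `(0, T) × ∂Ω`, `u(0) = u₀`.
The initial value is attained in `L²(Ω)`. -/
structure SolvesRotational (Ω : Set E3) (T ν : ℝ) (u₀ : E3 → E3) (f b : ℝ → E3 → E3)
    (u : ℝ → E3 → E3) (q : ℝ → E3 → ℝ) : Prop where
  differentiable_time : ∀ t ∈ Ioo 0 T, ∀ x ∈ Ω, DifferentiableAt ℝ (fun τ => u τ x) t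
  contDiffOn_velocity : ∀ t ∈ Ioo 0 T, ContDiffOn ℝ 2 (u t) Ω
  continuousOn_velocity : ∀ t ∈ Ioo 0 T, ContinuousOn (u t) (closure Ω)
  contDiffOn_pressure : ∀ t ∈ Ioo 0 T, ContDiffOn ℝ 1 (q t) Ω
  momentum : ∀ t ∈ Ioo 0 T, ∀ x ∈ Ω,
    deriv (fun τ => u τ x) t + cross (curl (u t) x) (u t x) + b t x
      - ν • Laplacian.laplacian (u t) x + gradient (q t) x = f t x
  incompressible : ∀ t ∈ Ioo 0 T, ∀ x ∈ Ω, div (u t) x = 0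
  no_slip : ∀ t ∈ Ioo 0 T, ∀ x ∈ frontier Ω, u t x = 0
  initial : ∀ x ∈ Ω, u 0 x = u₀ x
  initial_attained :
    Tendsto (fun t => eLpNorm (fun x => u t x - u₀ x) 2 (volume.restrict Ω)) (𝓝[>] 0) (𝓝 0)

/-- `(v, π)` is a classical solution of the Navier-Stokes equations with force `f` and initial
value `v₀`, the convective term being written in rotational form:
`v_t + curl v × v - ν Δv + ∇(π + |v|²/2) = f`. -/
def SolvesNavierStokes (Ω : Set E3) (T ν : ℝ) (v₀ : E3 → E3) (f : ℝ → E3 → E3)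
    (v : ℝ → E3 → E3) (π : ℝ → E3 → ℝ) : Prop :=
  SolvesRotational Ω T ν v₀ f (fun _ _ => 0) v (fun t x => π t x + ‖v t x‖ ^ 2 / 2)

/-! ### Random fields, means and fluctuations -/

section Statistics

variable {X : Type*} [MeasurableSpace X] {F : Type*} [NormedAddCommGroup F] [NormedSpace ℝ F]

/-- The statistical mean of a random field. -/
noncomputable def mean (P : Measure X) (ψ : ℝ → E3 → X → F) (t : ℝ) (x : E3) : F :=
  ∫ ω, ψ t x ω ∂P

/-- The fluctuation `ψ' = ψ - mean ψ` of a random field. -/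
noncomputable def fluct (P : Measure X) (ψ : ℝ → E3 → X → F) (t : ℝ) (x : E3) (ω : X) : F :=
  ψ t x ω - mean P ψ t x

/-- The random vorticity field of a random velocity field. -/
noncomputable def vorticity (v : ℝ → E3 → X → E3) (t : ℝ) (x : E3) (ω : X) : E3 :=
  curl (fun y => v t y ω) x

/-- The turbulent stress vector `s`, the mean of `vorticity' × velocity'`. Since the velocity
vanishes on the boundary, so does `s`, whatever the vorticity is there. -/
noncomputable def turbulentStress (P : Measure X) (v : ℝ → E3 → X → E3) (t : ℝ) (x : E3) : E3 :=
  mean P (fun t x ω => cross (fluct P (vorticity v) t x ω) (fluct P v t x ω)) t x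

/-- The turbulent kinetic energy `k`, half of the mean of `|velocity'|²`. -/
noncomputable def turbulentEnergy (P : Measure X) (v : ℝ → E3 → X → E3) (t : ℝ) (x : E3) : ℝ :=
  (1 / 2) * mean P (fun t x ω => ‖fluct P v t x ω‖ ^ 2) t x

/-- Measurability of the random fields, and square-integrable bounds that make statistical means
of the fields meaningful. On compact subintervals of `(0, T)`, velocity and velocity gradient are
bounded by a square-integrable random variable `M`, while the derivatives of higher order and the
pressure may in addition grow towards the boundary like an integrable function `g`; near the
initial time only the `L²(Ω)` norm of the velocity is controlled. -/
structure HasSecondMoments (P : Measure X) (Ω : Set E3) (T : ℝ) (v₀ : E3 → X → E3)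
    (v : ℝ → E3 → X → E3) (π : ℝ → E3 → X → ℝ) : Prop where
  measurable_velocity : ∀ t ∈ Ioo 0 T, ∀ x ∈ Ω, Measurable (v t x)
  measurable_pressure : ∀ t ∈ Ioo 0 T, ∀ x ∈ Ω, Measurable (π t x)
  measurable_initial : Measurable (fun z : E3 × X => v₀ z.1 z.2)
  bounds : ∀ t₁ t₂ : ℝ, 0 < t₁ → t₂ < T → ∃ M : X → ℝ, ∃ g : E3 → ℝ,
    MemLp M 2 P ∧ ContinuousOn g Ω ∧ IntegrableOn g Ω ∧
    ∀ t ∈ Icc t₁ t₂, ∀ x ∈ Ω, ∀ ω,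
      ‖v t x ω‖ ≤ M ω ∧
      ‖fderiv ℝ (fun y => v t y ω) x‖ ≤ M ω ∧
      ‖fderiv ℝ (fderiv ℝ (fun y => v t y ω)) x‖ ≤ M ω * g x ∧
      ‖deriv (fun τ => v τ x ω) t‖ ≤ M ω ^ 2 * g x ∧
      |π t x ω| ≤ M ω ^ 2 * g x ∧
      ‖fderiv ℝ (fun y => π t y ω) x‖ ≤ M ω ^ 2 * g x
  energy_bound : ∃ δ > 0, ∃ M : X → ℝ, MemLp M 2 P ∧ ∀ t ∈ Ioo 0 δ, ∀ ω,
    eLpNorm (fun x => v t x ω) 2 (volume.restrict Ω) ≤ ENNReal.ofReal (M ω)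

end Statistics

end Reynolds

/-! Averaging commutes with every linear operation in the equations: the bounds by `M` and `g`
dominate the integrands, so one may differentiate under the integral over the probability space.
Only the quadratic terms leave a remainder. By the covariance formula
`integral_bilinear_fluctuation`, the mean of vorticity × velocity is the product of the means plus
the stress s, and the mean of |v|²/2 is half the square of the mean velocity plus k. It remains to
write s as curl a − ∇Φ and to move ∇Φ into the pressure.

This is the Helmholtz decomposition `curl_vectorPotential_sub_gradient_scalarPotential`. As s
vanishes on the boundary, both surface integrals are zero, and a and Φ are Newtonian potentials of
curl s and div s. The identity is then curl curl − grad div = −Δ, expressed through the integrals of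
∂ᵢ(1/|x − y|) against ∂ⱼsₖ. Two facts suffice: these integrals are symmetric in i and j, and their
trace over i = j is −4πsₖ(x).

Both facts are proved for the regularized kernel (|z|² + ε²)^(-1/2), where a derivative can be moved
from s to the kernel. The Hessian of that kernel is symmetric, and its Laplacian is −4π times an
approximate identity. The limit ε → 0 is controlled by a √ε error against the kernel |z|^(-5/2),
still locally integrable in dimension three. The derivatives of s may blow up at the boundary and
are merely integrable, so the integration by parts `setIntegral_fderiv_mul_eq_neg` first truncates s
near its zero set and extends by zero.

The initial value is attained in the mean by Jensen's inequality in ω, Tonelli's theorem and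
dominated convergence (`tendsto_eLpNorm_mean_sub`). -/

namespace Reynolds

/-! ### Integration by parts without boundary regularity -/

/-- `C¹` approximations of the identity of `ℝ` that vanish near zero. -/
lemma exists_truncation : ∃ θ θ' : ℕ → ℝ → ℝ,
    (∀ n r, HasDerivAt (θ n) (θ' n r) r) ∧ (∀ n, Continuous (θ' n)) ∧ (∀ n r, |θ' n r| ≤ 1) ∧
    (∀ n r, |θ n r| ≤ |r|) ∧
    (∀ (n : ℕ) (r : ℝ), |r| < 1 / ((n : ℝ) + 1) → θ n r = 0) ∧
    (∀ r, Tendsto (fun n => θ n r) atTop (𝓝 r)) ∧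
    (∀ r, r ≠ 0 → Tendsto (fun n => θ' n r) atTop (𝓝 1)) := by
  -- A continuous ramp: zero for |r| ≤ 1/(n+1), one for |r| ≥ 2/(n+1), linear in |r| between. The
  -- truncation is its primitive from 0.
  let k : ℕ → ℝ → ℝ := fun n r => min 1 (max 0 (((n : ℝ) + 1) * |r| - 1))
  have hk : ∀ n, Continuous (k n) := fun n => by fun_prop
  have hk1 : ∀ n r, |k n r| ≤ 1 := fun n r => by
    rw [abs_of_nonneg (le_min zero_le_one (le_max_left _ _))]
    exact min_le_left _ _
  have hlim : ∀ r, r ≠ 0 → Tendsto (fun n => k n r) atTop (𝓝 1) := by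
    intro r hr
    refine tendsto_const_nhds.congr' ?_
    obtain ⟨N, hN⟩ := exists_nat_gt (2 / |r|)
    filter_upwards [eventually_ge_atTop N] with n hn
    have hr' : 0 < |r| := abs_pos.2 hr
    rw [div_lt_iff₀ hr'] at hN
    have hn' : (N : ℝ) ≤ n := by exact_mod_cast hn
    have : 1 ≤ ((n : ℝ) + 1) * |r| - 1 := by nlinarith
    exact (min_eq_left (this.trans (le_max_right _ _))).symm
  refine ⟨fun n r => ∫ t in (0 : ℝ)..r, k n t, k,
    fun n r => ?_, hk, hk1, fun n r => ?_, fun n r hr => ?_, fun r => ?_, hlim⟩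
  · exact intervalIntegral.integral_hasDerivAt_right ((hk n).intervalIntegrable _ _)
      ((hk n).stronglyMeasurableAtFilter _ _) (hk n).continuousAt
  · have := intervalIntegral.norm_integral_le_of_norm_le_const (a := 0) (b := r) (f := k n)
      (C := 1) (fun x _ => hk1 n x)
    simpa using this
  · apply intervalIntegral.integral_zero_ae
    refine Eventually.of_forall fun t ht => ?_
    have ht' : |t| ≤ |r| := by
      rcases le_total 0 r with h | h
      · rw [uIoc_of_le h] at ht
        rw [abs_of_pos ht.1, abs_of_nonneg h]; exact ht.2
      · rw [uIoc_of_ge h] at ht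
        rw [abs_of_nonpos ht.2, abs_of_nonpos h]; linarith [ht.1]
    have hn : (0 : ℝ) < n + 1 := by positivity
    rw [lt_div_iff₀ hn] at hr
    have : ((n : ℝ) + 1) * |t| - 1 ≤ 0 := by nlinarith
    simp [k, max_eq_left this]
  · have : Tendsto (fun n => ∫ t in (0 : ℝ)..r, k n t) atTop (𝓝 (∫ _ in (0 : ℝ)..r, (1 : ℝ))) := by
      refine intervalIntegral.tendsto_integral_filter_of_dominated_convergence (fun _ => 1)
        (Eventually.of_forall fun n => (hk n).aestronglyMeasurable)
        (Eventually.of_forall fun n => Eventually.of_forall fun x _ => hk1 n x)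
        (by simp) ?_
      have h0 : ∀ᵐ t : ℝ, t ≠ 0 := by simp [ae_iff]
      filter_upwards [h0] with t ht _ using hlim t ht
    simpa using this

section

variable {E : Type*} [NormedAddCommGroup E] [NormedSpace ℝ E] [FiniteDimensional ℝ E]
  [MeasurableSpace E] [BorelSpace E] (μ : Measure E) [μ.IsAddHaarMeasure]

/-- The derivative of a differentiable function vanishes almost everywhere on its zero set. -/
lemma ae_fderiv_eq_zero_of_eq_zero {s : Set E} (hs : IsOpen s) {u : E → ℝ}
    (hu : DifferentiableOn ℝ u s) (e : E) :
    ∀ᵐ x ∂μ.restrict s, u x = 0 → fderiv ℝ u x e = 0 := by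
  rcases eq_or_ne e 0 with rfl | he
  · simp
  have hZ : MeasurableSet (s ∩ u ⁻¹' {0}) := by
    obtain ⟨t, ht, h⟩ := (continuousOn_iff_isClosed.1 hu.continuousOn) {0} isClosed_singleton
    rw [inter_comm, h]
    exact ht.measurableSet.inter hs.measurableSet
  -- On the zero set the map u • e is identically 0, so it is approximated there by the linear map 0
  -- with error constant 0; hence its derivative is 0 at almost every point of that set. Multiplying
  -- by e turns u into a map from E to E, as the lemma requires, and e ≠ 0 allows the factor to be
  -- removed again.
  have key := ApproximatesLinearOn.norm_fderiv_sub_le μ (f := fun x => u x • e) (A := 0) (δ := 0)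
    (s := s ∩ u ⁻¹' {0}) (by
      intro x hx y hy
      have h1 : u x = 0 := hx.2
      have h2 : u y = 0 := hy.2
      simp [h1, h2]) hZ (fun x => (fderiv ℝ u x).smulRight e) (fun x hx =>
      (((hu x hx.1).differentiableAt (hs.mem_nhds hx.1)).hasFDerivAt.smul_const e).hasFDerivWithinAt)
  rw [ae_restrict_iff' hZ] at key
  rw [ae_restrict_iff' hs.measurableSet]
  filter_upwards [key] with x hx hxs hux
  have h := hx ⟨hxs, hux⟩
  have h0 : (fderiv ℝ u x).smulRight e = 0 := by
    rw [← nnnorm_eq_zero]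
    simpa using h
  have h1 := congrArg (fun L : E →L[ℝ] E => L e) h0
  simpa [he] using h1

/-- Integration by parts for a function that vanishes on the boundary, with no regularity of the
boundary. -/
theorem setIntegral_fderiv_mul_eq_neg {s : Set E} (hs : IsOpen s) (hb : Bornology.IsBounded s)
    {u φ : E → ℝ} (hu : ContDiffOn ℝ 1 u s) (hc : ContinuousOn u (closure s))
    (h0 : ∀ x ∈ frontier s, u x = 0) (e : E)
    (hi : IntegrableOn (fun x => fderiv ℝ u x e) s μ) (hφ : ContDiff ℝ 1 φ) :
    ∫ x in s, fderiv ℝ u x e * φ x ∂μ = - ∫ x in s, u x * fderiv ℝ φ x e ∂μ := by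
  obtain ⟨θ, θ', hθ, hθc, hθ1, hθr, hθ0, hθl, hθl'⟩ := exists_truncation
  have hK : IsCompact (closure s) := hb.isCompact_closure
  have hφ' : Continuous fun x => fderiv ℝ φ x e :=
    (hφ.continuous_fderiv one_ne_zero).clm_apply continuous_const
  have hud : ∀ x ∈ s, HasFDerivAt u (fderiv ℝ u x) x := fun x hx =>
    ((hu.differentiableOn one_ne_zero x hx).differentiableAt (hs.mem_nhds hx)).hasFDerivAt
  obtain ⟨A, hA⟩ := hK.exists_bound_of_continuousOn hφ.continuous.continuousOn
  obtain ⟨A', hA'⟩ := hK.exists_bound_of_continuousOn hφ'.continuousOn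
  have hcs : ContinuousOn u s := hc.mono subset_closure
  have hφu : ContinuousOn (fun x => u x * fderiv ℝ φ x e) (closure s) := hc.mul hφ'.continuousOn
  have hθu : ∀ n, ContinuousOn (fun x => θ' n (u x)) s := fun n => (hθc n).comp_continuousOn hcs
  have hθcont : ∀ n, Continuous (θ n) := fun n =>
    continuous_iff_continuousAt.2 fun r => (hθ n r).continuousAt
  have hθu' : ∀ n, ContinuousOn (fun x => θ n (u x)) (closure s) := fun n =>
    (hθcont n).comp_continuousOn hc
  have hi1 : IntegrableOn (fun x => fderiv ℝ u x e * φ x) s μ := by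
    refine hi.mul_bdd (c := A) hφ.continuous.aestronglyMeasurable ?_
    rw [ae_restrict_iff' hs.measurableSet]
    exact Eventually.of_forall fun x hx => hA x (subset_closure hx)
  have hi2 : IntegrableOn (fun x => u x * fderiv ℝ φ x e) s μ :=
    (hφu.integrableOn_compact hK).mono_set subset_closure
  have main : ∀ n, ∫ x in s, θ' n (u x) * (fderiv ℝ u x e * φ x) ∂μ
      = - ∫ x in s, θ n (u x) * fderiv ℝ φ x e ∂μ := by
    intro n
    -- Truncation makes the extension by zero differentiable on the whole space: near a boundary
    -- point |u| < 1/(n+1), so the truncated function already vanishes in a neighbourhood.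
    -- Integration by parts on the whole space then applies.
    have hU : ∀ x, HasFDerivAt (s.indicator fun y => θ n (u y))
        (s.indicator (fun y => θ' n (u y) • fderiv ℝ u y) x) x := by
      intro x
      by_cases hx : x ∈ s
      · rw [indicator_of_mem hx]
        refine ((hθ n (u x)).comp_hasFDerivAt x (hud x hx)).congr_of_eventuallyEq ?_
        filter_upwards [hs.mem_nhds hx] with y hy
        simp [indicator_of_mem hy]
      · rw [indicator_of_notMem hx]
        refine (hasFDerivAt_const (0 : ℝ) x).congr_of_eventuallyEq ?_
        by_cases hx' : x ∈ closure s
        · have hxf : x ∈ frontier s := ⟨hx', by rwa [hs.interior_eq]⟩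
          have h1 := hc x hx'
          have h2 : ∀ᶠ y in 𝓝[closure s] x, |u y| < 1 / ((n : ℝ) + 1) := by
            have h3 : Tendsto (fun y => |u y|) (𝓝[closure s] x) (𝓝 |u x|) := h1.abs
            rw [h0 x hxf, abs_zero] at h3
            exact h3.eventually (gt_mem_nhds (by positivity))
          filter_upwards [eventually_nhdsWithin_iff.1 h2] with y hy
          by_cases hys : y ∈ s
          · rw [indicator_of_mem hys, hθ0 n _ (hy (subset_closure hys))]
          · rw [indicator_of_notMem hys]
        · filter_upwards [isClosed_closure.isOpen_compl.mem_nhds hx'] with y hy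
          rw [indicator_of_notMem fun h => hy (subset_closure h)]
    have e1 : (fun x => fderiv ℝ (s.indicator fun y => θ n (u y)) x e * φ x)
        = s.indicator fun x => θ' n (u x) * (fderiv ℝ u x e * φ x) := by
      ext x
      rw [(hU x).fderiv]
      by_cases hx : x ∈ s <;> simp [hx, mul_assoc]
    have e2 : (fun x => (s.indicator fun y => θ n (u y)) x * fderiv ℝ φ x e)
        = s.indicator fun x => θ n (u x) * fderiv ℝ φ x e := by
      ext x
      by_cases hx : x ∈ s <;> simp [hx]
    have e3 : (fun x => (s.indicator fun y => θ n (u y)) x * φ x)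
        = s.indicator fun x => θ n (u x) * φ x := by
      ext x
      by_cases hx : x ∈ s <;> simp [hx]
    have := integral_mul_fderiv_eq_neg_fderiv_mul_of_integrable (μ := μ) (v := e)
      (f := s.indicator fun y => θ n (u y)) (g := φ) ?_ ?_ ?_
      (fun x _ => (hU x).differentiableAt) (fun x _ => hφ.differentiable one_ne_zero x)
    · rw [e1, e2, integral_indicator hs.measurableSet, integral_indicator hs.measurableSet] at this
      linarith
    · rw [e1, integrable_indicator_iff hs.measurableSet]
      exact hi1.bdd_mul (c := 1) ((hθu n).aestronglyMeasurable hs.measurableSet)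
        (Eventually.of_forall fun x => hθ1 n _)
    · rw [e2, integrable_indicator_iff hs.measurableSet]
      exact (((hθu' n).mul hφ'.continuousOn).integrableOn_compact hK).mono_set subset_closure
    · rw [e3, integrable_indicator_iff hs.measurableSet]
      exact (((hθu' n).mul hφ.continuous.continuousOn).integrableOn_compact hK).mono_set
        subset_closure
  have l1 : Tendsto (fun n => ∫ x in s, θ' n (u x) * (fderiv ℝ u x e * φ x) ∂μ) atTop
      (𝓝 (∫ x in s, fderiv ℝ u x e * φ x ∂μ)) := by
    refine tendsto_integral_of_dominated_convergence (fun x => ‖fderiv ℝ u x e * φ x‖)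
      (fun n => ((hθu n).aestronglyMeasurable hs.measurableSet).mul hi1.aestronglyMeasurable)
      hi1.norm (fun n => Eventually.of_forall fun x => ?_) ?_
    · rw [norm_mul]
      exact mul_le_of_le_one_left (norm_nonneg _) (hθ1 n _)
    -- Where u ≠ 0 the factor θ' tends to 1; where u = 0 it need not, but there the derivative of u
    -- is zero almost everywhere.
    · filter_upwards [ae_fderiv_eq_zero_of_eq_zero μ hs (hu.differentiableOn one_ne_zero) e]
        with x hx
      by_cases hux : u x = 0
      · simp [hx hux]
      · simpa using (hθl' _ hux).mul_const (fderiv ℝ u x e * φ x)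
  have l2 : Tendsto (fun n => ∫ x in s, θ n (u x) * fderiv ℝ φ x e ∂μ) atTop
      (𝓝 (∫ x in s, u x * fderiv ℝ φ x e ∂μ)) := by
    refine tendsto_integral_of_dominated_convergence (fun x => ‖u x * fderiv ℝ φ x e‖)
      (fun n => (((hθu' n).mono subset_closure).mul
        hφ'.continuousOn).aestronglyMeasurable hs.measurableSet)
      hi2.norm (fun n => Eventually.of_forall fun x => ?_)
      (Eventually.of_forall fun x => (hθl _).mul_const _)
    rw [norm_mul, norm_mul]
    exact mul_le_mul_of_nonneg_right (hθr n _) (norm_nonneg _)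
  refine tendsto_nhds_unique l1 ?_
  simp_rw [main]
  exact l2.neg

end

/-! ### The Newtonian kernel and its regularization -/

/-- The regularized norm `√(|z|² + ε²)`. -/
noncomputable def softNorm (ε : ℝ) (z : E3) : ℝ := √(‖z‖ ^ 2 + ε ^ 2)

/-- The derivative `-⟨z, ·⟩ / (|z|² + ε²)^(3/2)` of the regularized Newtonian kernel. -/
noncomputable def newtonGrad (ε : ℝ) (z : E3) : E3 →L[ℝ] ℝ :=
  (-(softNorm ε z)⁻¹ ^ 3) • innerSL ℝ z

lemma softNorm_zero (z : E3) : softNorm 0 z = ‖z‖ := by simp [softNorm]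

lemma softNorm_sq (ε : ℝ) (z : E3) : softNorm ε z ^ 2 = ‖z‖ ^ 2 + ε ^ 2 :=
  Real.sq_sqrt (by positivity)

lemma softNorm_nonneg (ε : ℝ) (z : E3) : 0 ≤ softNorm ε z := Real.sqrt_nonneg _

lemma softNorm_pos {ε : ℝ} (hε : 0 < ε) (z : E3) : 0 < softNorm ε z :=
  Real.sqrt_pos.2 (by positivity)

lemma norm_le_softNorm (ε : ℝ) (z : E3) : ‖z‖ ≤ softNorm ε z :=
  Real.le_sqrt_of_sq_le (by nlinarith [sq_nonneg ε])

lemma le_softNorm (ε : ℝ) (z : E3) : ε ≤ softNorm ε z :=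
  Real.le_sqrt_of_sq_le (by nlinarith [sq_nonneg ‖z‖])

lemma softNorm_le {ε : ℝ} (hε : 0 ≤ ε) (z : E3) : softNorm ε z ≤ ‖z‖ + ε := by
  refine Real.sqrt_le_iff.2 ⟨by positivity, ?_⟩
  nlinarith [mul_nonneg (norm_nonneg z) hε]

lemma continuous_softNorm (ε : ℝ) : Continuous (softNorm ε) := by
  unfold softNorm; fun_prop

lemma hasFDerivAt_softNorm {ε : ℝ} (hε : 0 < ε) (z : E3) :
    HasFDerivAt (softNorm ε) ((softNorm ε z)⁻¹ • innerSL ℝ z) z := by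
  have h1 : HasFDerivAt (fun z : E3 => ‖z‖ ^ 2 + ε ^ 2) (2 • innerSL ℝ z) z :=
    (hasStrictFDerivAt_norm_sq z).hasFDerivAt.add_const _
  have h2 := h1.sqrt (by positivity)
  refine h2.congr_fderiv ?_
  ext y
  simp only [smul_apply, smul_eq_mul, nsmul_eq_mul, softNorm, innerSL_apply_apply]
  field_simp
  norm_num

lemma hasFDerivAt_inv_softNorm {ε : ℝ} (hε : 0 < ε) (z : E3) :
    HasFDerivAt (fun z => (softNorm ε z)⁻¹) (newtonGrad ε z) z := by
  have h := (hasDerivAt_inv (softNorm_pos hε z).ne').comp_hasFDerivAt z (hasFDerivAt_softNorm hε z)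
  refine h.congr_fderiv ?_
  have := softNorm_pos hε z
  ext y
  simp only [newtonGrad, smul_apply, smul_eq_mul]
  field_simp

lemma hasFDerivAt_newtonGrad_apply {ε : ℝ} (hε : 0 < ε) (e z : E3) :
    HasFDerivAt (fun z => newtonGrad ε z e)
      ((3 * (softNorm ε z)⁻¹ ^ 5 * inner ℝ z e) • innerSL ℝ z
        - (softNorm ε z)⁻¹ ^ 3 • innerSL ℝ e) z := by
  have h1 := ((hasFDerivAt_inv_softNorm hε z).pow 3).neg
  have h2 : HasFDerivAt (fun z : E3 => inner ℝ z e) (innerSL ℝ e) z := by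
    have := (innerSL ℝ e).hasFDerivAt (x := z)
    refine this.congr_of_eventuallyEq (Eventually.of_forall fun y => ?_)
    simp [real_inner_comm]
  have h3 := h1.mul h2
  refine h3.congr_fderiv ?_
  ext y
  simp [newtonGrad]
  ring

lemma contDiff_newtonGrad_apply {ε : ℝ} (hε : 0 < ε) (e : E3) :
    ContDiff ℝ 1 fun z => newtonGrad ε z e := by
  have h : ContDiff ℝ 1 (softNorm ε) :=
    ((contDiff_norm_sq ℝ).add contDiff_const).sqrt fun z => by positivity
  exact (((h.inv fun z => (softNorm_pos hε z).ne').pow 3).neg).mul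
    (contDiff_id.inner ℝ contDiff_const)

lemma continuous_newtonGrad {ε : ℝ} (hε : 0 < ε) : Continuous (newtonGrad ε) := by
  have h : Continuous fun z => (softNorm ε z)⁻¹ :=
    (continuous_softNorm ε).inv₀ fun z => (softNorm_pos hε z).ne'
  exact (h.pow 3).neg.smul (innerSL ℝ).continuous

lemma measurable_newtonGrad (ε : ℝ) : Measurable (newtonGrad ε) :=
  ((continuous_softNorm ε).measurable.inv.pow_const 3).neg.smul (innerSL ℝ).continuous.measurable

lemma norm_newtonGrad (ε : ℝ) (z : E3) : ‖newtonGrad ε z‖ = (softNorm ε z)⁻¹ ^ 3 * ‖z‖ := by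
  have := softNorm_nonneg ε z
  rw [newtonGrad, norm_smul, innerSL_apply_norm, norm_neg, Real.norm_of_nonneg (by positivity)]

lemma norm_newtonGrad_le {ε : ℝ} (hε : 0 < ε) (z : E3) : ‖newtonGrad ε z‖ ≤ ε⁻¹ ^ 2 := by
  have h0 := softNorm_pos hε z
  calc ‖newtonGrad ε z‖ ≤ (softNorm ε z)⁻¹ ^ 3 * softNorm ε z := by
        rw [norm_newtonGrad]; gcongr; exact norm_le_softNorm ε z
    _ = (softNorm ε z)⁻¹ ^ 2 := by field_simp
    _ ≤ ε⁻¹ ^ 2 := by gcongr; exact le_softNorm ε z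

lemma norm_newtonGrad_zero (z : E3) : ‖newtonGrad 0 z‖ = ‖z‖ ^ (-(2 : ℝ)) := by
  rw [norm_newtonGrad, softNorm_zero]
  -- At the origin both sides are 0 by the conventions for the inverse and for negative powers of
  -- zero.
  rcases eq_or_ne z 0 with rfl | hz
  · simp
  · have : 0 < ‖z‖ := norm_pos_iff.2 hz
    rw [Real.rpow_neg this.le, Real.rpow_two]
    field_simp

/-- A bound linear in ε would cost |z|^(-3), which is not locally integrable in dimension three.
Using √ε √|z| ≤ `softNorm ε z` gives up half a power of ε and leaves the integrable singularity
|z|^(-5/2). -/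
lemma norm_newtonGrad_sub_le {ε : ℝ} (hε : 0 < ε) (z : E3) :
    ‖newtonGrad 0 z - newtonGrad ε z‖ ≤ 3 * √ε * ‖z‖ ^ (-(5 / 2) : ℝ) := by
  rcases eq_or_ne z 0 with rfl | hz
  · simp [newtonGrad]
  have hr : 0 < ‖z‖ := norm_pos_iff.2 hz
  have hw := softNorm_pos hε z
  have hrw := norm_le_softNorm ε z
  have hwe := softNorm_le hε.le z
  have hsq := softNorm_sq ε z
  have hsub : newtonGrad 0 z - newtonGrad ε z
      = (-‖z‖⁻¹ ^ 3 - -(softNorm ε z)⁻¹ ^ 3) • innerSL ℝ z := by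
    rw [newtonGrad, newtonGrad, softNorm_zero]; exact (sub_smul _ _ _).symm
  rw [hsub, norm_smul, innerSL_apply_norm]
  set r := ‖z‖
  set w := softNorm ε z
  have h1 : w⁻¹ ^ 3 ≤ r⁻¹ ^ 3 := by gcongr
  have h2 : ‖-r⁻¹ ^ 3 - -w⁻¹ ^ 3‖ = r⁻¹ ^ 3 - w⁻¹ ^ 3 := by
    rw [Real.norm_eq_abs, abs_of_nonpos (by linarith)]; ring
  have h3 : √ε * √r ≤ w := by
    rw [← Real.sqrt_mul hε.le]
    refine Real.sqrt_le_iff.2 ⟨hw.le, ?_⟩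
    nlinarith [sq_nonneg (ε - r)]
  have h4 : r ^ (-(5 / 2) : ℝ) = (r ^ 2 * √r)⁻¹ := by
    rw [Real.rpow_neg hr.le, Real.sqrt_eq_rpow, ← Real.rpow_two, ← Real.rpow_add hr]
    norm_num
  have hs : 0 < √r := Real.sqrt_pos.2 hr
  have hse : 0 < √ε := Real.sqrt_pos.2 hε
  have hsr : √r * √r = r := Real.mul_self_sqrt hr.le
  have hsee : √ε * √ε = ε := Real.mul_self_sqrt hε.le
  rw [h2, h4]
  have h5 : (r⁻¹ ^ 3 - w⁻¹ ^ 3) * r = (w ^ 3 - r ^ 3) / (r ^ 2 * w ^ 3) := by field_simp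
  rw [h5, ← div_eq_mul_inv, div_le_div_iff₀ (by positivity) (by positivity)]
  have h6 : w ^ 3 - r ^ 3 ≤ 3 * ε * w ^ 2 := by
    have : w ^ 3 - r ^ 3 = (w - r) * (w ^ 2 + w * r + r ^ 2) := by ring
    rw [this]
    have h7 : w ^ 2 + w * r + r ^ 2 ≤ 3 * w ^ 2 := by nlinarith
    have h8 : w - r ≤ ε := by linarith
    calc (w - r) * (w ^ 2 + w * r + r ^ 2) ≤ ε * (3 * w ^ 2) := by
          apply mul_le_mul h8 h7 (by positivity) hε.le
      _ = _ := by ring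
  calc (w ^ 3 - r ^ 3) * (r ^ 2 * √r) ≤ (3 * ε * w ^ 2) * (r ^ 2 * √r) := by gcongr
    _ = 3 * √ε * (r ^ 2 * w ^ 2) * (√ε * √r) := by
          linear_combination (-3 * w ^ 2 * r ^ 2 * √r) * hsee
    _ ≤ 3 * √ε * (r ^ 2 * w ^ 2) * w := by gcongr
    _ = _ := by ring

/-! ### Weakly singular integrals -/

lemma integrableOn_norm_rpow_ball {p : ℝ} (hp : p < 3) (R : ℝ) :
    IntegrableOn (fun z : E3 => ‖z‖ ^ (-p)) (Metric.ball 0 R) := by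
  rw [integrableOn_fun_norm_addHaar volume (f := fun r => r ^ (-p))]
  have h := (intervalIntegral.intervalIntegrable_rpow' (a := 0) (b := R) (r := 2 - p)
    (by linarith)).1
  refine (h.mono_set Ioo_subset_Ioc_self).congr_fun (fun y hy => ?_) measurableSet_Ioo
  have : Module.finrank ℝ E3 = 3 := by simp
  simp only [this, smul_eq_mul]
  rw [sub_eq_add_neg, Real.rpow_add hy.1]
  norm_num

variable {F : Type*} [NormedAddCommGroup F]

/-- Within distance r of x the density is bounded and the kernel integrable, since p < 3; farther
away the kernel is at most r^(-p) and the density integrable. The constant serves all x near x₀,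
which is what locally uniform convergence needs. -/
lemma exists_bound_weaklySingular {Ω : Set E3} (hΩ : IsOpen Ω) {ρ : E3 → F}
    (hi : IntegrableOn ρ Ω) (hc : ContinuousOn ρ Ω) {x₀ : E3} (hx₀ : x₀ ∈ Ω) {p : ℝ}
    (hp0 : 0 ≤ p) (hp : p < 3) :
    ∃ C : ℝ, ∀ᶠ x in 𝓝 x₀, IntegrableOn (fun y => ‖x - y‖ ^ (-p) * ‖ρ y‖) Ω ∧
      ∫ y in Ω, ‖x - y‖ ^ (-p) * ‖ρ y‖ ≤ C := by
  obtain ⟨R, hR, hRΩ⟩ := Metric.isOpen_iff.1 hΩ x₀ hx₀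
  -- If x is within r of x₀ and y within r of x, then y lies in the closed ball of radius 2r, a
  -- compact subset of Ω.
  set r := R / 3 with hr_def
  have hr : 0 < r := by positivity
  have hsub : Metric.closedBall x₀ (2 * r) ⊆ Ω := fun y hy => hRΩ <| by
    rw [Metric.mem_closedBall] at hy; rw [Metric.mem_ball]; linarith
  obtain ⟨B, hB⟩ := (isCompact_closedBall x₀ (2 * r)).exists_bound_of_continuousOn (hc.mono hsub)
  have hB0 : 0 ≤ B := (norm_nonneg _).trans (hB x₀ (Metric.mem_closedBall_self (by positivity)))
  have hk := integrableOn_norm_rpow_ball hp r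
  rw [← integrable_indicator_iff Metric.isOpen_ball.measurableSet] at hk
  set k : E3 → ℝ := (Metric.ball 0 r).indicator fun z => ‖z‖ ^ (-p) with hk_def
  have hk0 : ∀ z, 0 ≤ k z := fun z => indicator_nonneg (fun z _ => by positivity) z
  refine ⟨B * (∫ z, k z) + r ^ (-p) * ∫ y in Ω, ‖ρ y‖, ?_⟩
  filter_upwards [Metric.ball_mem_nhds x₀ hr] with x hx
  have hkx : Integrable fun y => k (x - y) := hk.comp_sub_left x
  have hdom : Integrable (fun y => B * k (x - y) + r ^ (-p) * ‖ρ y‖) (volume.restrict Ω) :=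
    (hkx.integrableOn.const_mul B).add (hi.norm.const_mul _)
  have hle : ∀ y ∈ Ω, ‖x - y‖ ^ (-p) * ‖ρ y‖ ≤ B * k (x - y) + r ^ (-p) * ‖ρ y‖ := by
    intro y hy
    by_cases hxy : ‖x - y‖ < r
    · have hm : x - y ∈ Metric.ball (0 : E3) r := by simpa using hxy
      have hyB : ‖ρ y‖ ≤ B := hB y <| by
        rw [Metric.mem_closedBall]
        have h1 : dist y x < r := by rw [dist_eq_norm, norm_sub_rev]; exact hxy
        have := dist_triangle y x x₀
        rw [Metric.mem_ball] at hx
        linarith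
      rw [hk_def, indicator_of_mem hm, mul_comm B]
      have : 0 ≤ r ^ (-p) * ‖ρ y‖ := by positivity
      have : ‖x - y‖ ^ (-p) * ‖ρ y‖ ≤ ‖x - y‖ ^ (-p) * B := by gcongr
      linarith
    · have h1 : ‖x - y‖ ^ (-p) ≤ r ^ (-p) :=
        Real.rpow_le_rpow_of_nonpos hr (not_lt.1 hxy) (by linarith)
      have : ‖x - y‖ ^ (-p) * ‖ρ y‖ ≤ r ^ (-p) * ‖ρ y‖ := by gcongr
      have := mul_nonneg hB0 (hk0 (x - y))
      linarith
  have hmeas : AEStronglyMeasurable (fun y => ‖x - y‖ ^ (-p) * ‖ρ y‖) (volume.restrict Ω) :=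
    (((continuous_const.sub continuous_id).norm.measurable.pow_const
      (-p)).aestronglyMeasurable).mul hi.norm.aestronglyMeasurable
  have hint : IntegrableOn (fun y => ‖x - y‖ ^ (-p) * ‖ρ y‖) Ω := by
    refine Integrable.mono' hdom hmeas ?_
    rw [ae_restrict_iff' hΩ.measurableSet]
    refine Eventually.of_forall fun y hy => ?_
    rw [Real.norm_of_nonneg (by positivity)]
    exact hle y hy
  refine ⟨hint, (setIntegral_mono_on hint hdom hΩ.measurableSet hle).trans ?_⟩
  rw [integral_add (hkx.integrableOn.const_mul B) (hi.norm.const_mul _), integral_const_mul,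
    integral_const_mul]
  gcongr
  calc ∫ y in Ω, k (x - y) ≤ ∫ y, k (x - y) :=
        setIntegral_le_integral hkx (Eventually.of_forall fun y => hk0 _)
    _ = ∫ z, k z := integral_sub_left_eq_self k volume x

lemma integrableOn_weaklySingular {Ω : Set E3} (hΩ : IsOpen Ω) {ρ : E3 → F}
    (hi : IntegrableOn ρ Ω) (hc : ContinuousOn ρ Ω) {x : E3} (hx : x ∈ Ω) {p : ℝ}
    (hp0 : 0 ≤ p) (hp : p < 3) : IntegrableOn (fun y => ‖x - y‖ ^ (-p) * ‖ρ y‖) Ω := by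
  obtain ⟨C, hC⟩ := exists_bound_weaklySingular hΩ hi hc hx hp0 hp
  exact hC.self_of_nhds.1

/-! ### Continuous differentiability of Newtonian potentials. -/

section NewtonPotential

variable {F : Type*} [NormedAddCommGroup F] [NormedSpace ℝ F] {Ω : Set E3} {ρ : E3 → F}

lemma contDiffOn_one_of_hasFDerivAt {E G : Type*} [NormedAddCommGroup E] [NormedSpace ℝ E]
    [NormedAddCommGroup G] [NormedSpace ℝ G] {s : Set E} (hs : IsOpen s) {f : E → G}
    {f' : E → E →L[ℝ] G} (h : ∀ x ∈ s, HasFDerivAt f (f' x) x) (hc : ContinuousOn f' s) :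
    ContDiffOn ℝ 1 f s := by
  have := (contDiffOn_succ_iff_fderiv_of_isOpen (𝕜 := ℝ) (f := f) (n := 0) hs).2
    ⟨fun x hx => (h x hx).differentiableAt.differentiableWithinAt, by simp, by
      rw [contDiffOn_zero]
      exact hc.congr fun x hx => (h x hx).fderiv⟩
  simpa using this

lemma norm_smulRight_newtonGrad_zero_le (x y : E3) (c : F) :
    ‖(newtonGrad 0 (x - y)).smulRight c‖ = ‖x - y‖ ^ (-(2 : ℝ)) * ‖c‖ := by
  rw [ContinuousLinearMap.norm_smulRight_apply, norm_newtonGrad_zero]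

lemma aestronglyMeasurable_newtonGrad_smulRight (ε : ℝ) (hi : IntegrableOn ρ Ω) (x : E3) :
    AEStronglyMeasurable (fun y => (newtonGrad ε (x - y)).smulRight (ρ y))
      (volume.restrict Ω) := by
  have h1 : AEStronglyMeasurable (fun y => newtonGrad ε (x - y)) (volume.restrict Ω) :=
    ((measurable_newtonGrad ε).comp (measurable_const.sub measurable_id)).aestronglyMeasurable
  exact (ContinuousLinearMap.smulRightL ℝ E3 F).aestronglyMeasurable_comp₂ h1
    hi.aestronglyMeasurable

lemma integrableOn_newtonGrad_smulRight (hΩ : IsOpen Ω) (hi : IntegrableOn ρ Ω)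
    (hc : ContinuousOn ρ Ω) {x : E3} (hx : x ∈ Ω) :
    IntegrableOn (fun y => (newtonGrad 0 (x - y)).smulRight (ρ y)) Ω :=
  Integrable.mono' (integrableOn_weaklySingular hΩ hi hc hx (p := 2) (by norm_num) (by norm_num))
    (aestronglyMeasurable_newtonGrad_smulRight 0 hi x)
    (Eventually.of_forall fun y => (norm_smulRight_newtonGrad_zero_le x y _).le)

lemma integrableOn_newtonGrad_smulRight_of_pos {ε : ℝ} (hε : 0 < ε) (hi : IntegrableOn ρ Ω)
    (x : E3) : IntegrableOn (fun y => (newtonGrad ε (x - y)).smulRight (ρ y)) Ω :=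
  Integrable.mono' (hi.norm.const_mul (ε⁻¹ ^ 2))
    (aestronglyMeasurable_newtonGrad_smulRight ε hi x)
    (Eventually.of_forall fun y => by
      rw [ContinuousLinearMap.norm_smulRight_apply]
      gcongr
      exact norm_newtonGrad_le hε _)

lemma integrableOn_newtonPotential (hΩ : IsOpen Ω) (hi : IntegrableOn ρ Ω)
    (hc : ContinuousOn ρ Ω) {x : E3} (hx : x ∈ Ω) :
    IntegrableOn (fun y => (1 / ‖x - y‖) • ρ y) Ω := by
  refine Integrable.mono' (integrableOn_weaklySingular hΩ hi hc hx (p := 1) (by norm_num)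
    (by norm_num)) ?_ (Eventually.of_forall fun y => ?_)
  · exact ((measurable_const.div (measurable_const.sub
      measurable_id).norm).aestronglyMeasurable).smul hi.aestronglyMeasurable
  · rw [norm_smul, Real.rpow_neg_one, one_div, norm_inv, norm_norm]

lemma norm_setIntegral_newtonGrad_sub_le (hΩ : IsOpen Ω) (hi : IntegrableOn ρ Ω)
    (hc : ContinuousOn ρ Ω) {x : E3} (hx : x ∈ Ω) {ε : ℝ} (hε : 0 < ε) :
    ‖(∫ y in Ω, (newtonGrad 0 (x - y)).smulRight (ρ y))
      - ∫ y in Ω, (newtonGrad ε (x - y)).smulRight (ρ y)‖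
      ≤ 3 * √ε * ∫ y in Ω, ‖x - y‖ ^ (-(5 / 2) : ℝ) * ‖ρ y‖ := by
  rw [← integral_sub (integrableOn_newtonGrad_smulRight hΩ hi hc hx)
    (integrableOn_newtonGrad_smulRight_of_pos hε hi x), ← integral_const_mul]
  refine norm_integral_le_of_norm_le ((integrableOn_weaklySingular hΩ hi hc hx (p := 5 / 2)
    (by norm_num) (by norm_num)).const_mul _) (Eventually.of_forall fun y => ?_)
  have : (newtonGrad 0 (x - y)).smulRight (ρ y) - (newtonGrad ε (x - y)).smulRight (ρ y)
      = (newtonGrad 0 (x - y) - newtonGrad ε (x - y)).smulRight (ρ y) := by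
    ext z; simp [sub_smul]
  rw [this, ContinuousLinearMap.norm_smulRight_apply, ← mul_assoc]
  gcongr
  exact norm_newtonGrad_sub_le hε _

/-- The regularization parameters `1 / (n + 1)`. -/
noncomputable def eps (n : ℕ) : ℝ := 1 / ((n : ℝ) + 1)

lemma eps_pos (n : ℕ) : 0 < eps n := by unfold eps; positivity

lemma tendsto_eps : Tendsto eps atTop (𝓝 0) := tendsto_one_div_add_atTop_nhds_zero_nat

lemma tendsto_sqrt_eps (C : ℝ) : Tendsto (fun n => 3 * √(eps n) * C) atTop (𝓝 0) := by
  have := ((Real.continuous_sqrt.tendsto 0).comp tendsto_eps).const_mul 3 |>.mul_const C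
  simpa using this

/-- The error is 3√ε times a potential with kernel |z|^(-5/2), which is bounded near each point of
Ω. This uniformity allows the limit potential to be differentiated and makes its derivative
continuous. -/
lemma tendstoLocallyUniformlyOn_newtonGrad (hΩ : IsOpen Ω) (hi : IntegrableOn ρ Ω)
    (hc : ContinuousOn ρ Ω) :
    TendstoLocallyUniformlyOn
      (fun n x => ∫ y in Ω, (newtonGrad (eps n) (x - y)).smulRight (ρ y))
      (fun x => ∫ y in Ω, (newtonGrad 0 (x - y)).smulRight (ρ y)) atTop Ω := by
  rw [Metric.tendstoLocallyUniformlyOn_iff]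
  intro δ hδ x₀ hx₀
  obtain ⟨C, hC⟩ := exists_bound_weaklySingular hΩ hi hc hx₀ (p := 5 / 2) (by norm_num)
    (by norm_num)
  refine ⟨_, mem_nhdsWithin_of_mem_nhds (inter_mem hC (hΩ.mem_nhds hx₀)), ?_⟩
  filter_upwards [(tendsto_sqrt_eps C).eventually (gt_mem_nhds hδ)] with n hn x hx
  rw [dist_eq_norm]
  refine ((norm_setIntegral_newtonGrad_sub_le hΩ hi hc hx.2 (eps_pos n)).trans ?_).trans_lt hn
  gcongr
  exact hx.1.2

lemma hasFDerivAt_softPotential {ε : ℝ} (hε : 0 < ε) (hi : IntegrableOn ρ Ω) (x : E3) :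
    HasFDerivAt (fun x => ∫ y in Ω, (softNorm ε (x - y))⁻¹ • ρ y)
      (∫ y in Ω, (newtonGrad ε (x - y)).smulRight (ρ y)) x := by
  have hm : ∀ x : E3, AEStronglyMeasurable (fun y => (softNorm ε (x - y))⁻¹ • ρ y)
      (volume.restrict Ω) := fun x =>
    ((((continuous_softNorm ε).measurable.comp
      (measurable_const.sub measurable_id)).inv).aestronglyMeasurable).smul hi.aestronglyMeasurable
  refine hasFDerivAt_integral_of_dominated_of_fderiv_le (s := univ)
    (F' := fun x y => (newtonGrad ε (x - y)).smulRight (ρ y)) (bound := fun y => ε⁻¹ ^ 2 * ‖ρ y‖) univ_mem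
    (Eventually.of_forall hm) ?_ (aestronglyMeasurable_newtonGrad_smulRight ε hi x)
    (Eventually.of_forall fun y x _ => ?_) (hi.norm.const_mul _)
    (Eventually.of_forall fun y x _ => ?_)
  · refine Integrable.mono' (hi.norm.const_mul ε⁻¹) (hm x) (Eventually.of_forall fun y => ?_)
    rw [norm_smul, norm_inv, Real.norm_of_nonneg (softNorm_nonneg _ _)]
    gcongr
    exact le_softNorm _ _
  · rw [ContinuousLinearMap.norm_smulRight_apply]
    gcongr
    exact norm_newtonGrad_le hε _
  · have h1 := (hasFDerivAt_inv_softNorm hε (x - y)).comp x ((hasFDerivAt_id x).sub_const y)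
    exact h1.smul_const (ρ y)

lemma continuous_softPotential_fderiv {ε : ℝ} (hε : 0 < ε) (hi : IntegrableOn ρ Ω) :
    Continuous fun x => ∫ y in Ω, (newtonGrad ε (x - y)).smulRight (ρ y) := by
  refine continuous_of_dominated (bound := fun y => ε⁻¹ ^ 2 * ‖ρ y‖)
    (aestronglyMeasurable_newtonGrad_smulRight ε hi)
    (fun x => Eventually.of_forall fun y => ?_) (hi.norm.const_mul _)
    (Eventually.of_forall fun y => ?_)
  · rw [ContinuousLinearMap.norm_smulRight_apply]
    gcongr
    exact norm_newtonGrad_le hε _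
  · have h : Continuous fun x => newtonGrad ε (x - y) :=
      (continuous_newtonGrad hε).comp (continuous_id.sub continuous_const)
    exact ((ContinuousLinearMap.smulRightL ℝ E3 F).flip (ρ y)).continuous.comp h

lemma tendsto_softPotential (hΩ : IsOpen Ω) (hi : IntegrableOn ρ Ω)
    (hc : ContinuousOn ρ Ω) {x : E3} (hx : x ∈ Ω) :
    Tendsto (fun n => ∫ y in Ω, (softNorm (eps n) (x - y))⁻¹ • ρ y) atTop
      (𝓝 (∫ y in Ω, (1 / ‖x - y‖) • ρ y)) := by
  have hne : ∀ᵐ y ∂(volume.restrict Ω), x ≠ y := by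
    refine ae_restrict_of_ae ?_
    have : ∀ᵐ y : E3, y ≠ x := by simp [ae_iff]
    filter_upwards [this] with y hy using hy.symm
  refine tendsto_integral_of_dominated_convergence (fun y => ‖(1 / ‖x - y‖) • ρ y‖)
    (fun n => ?_) (integrableOn_newtonPotential hΩ hi hc hx).norm (fun n => ?_) ?_
  · exact ((((continuous_softNorm _).measurable.comp
      (measurable_const.sub measurable_id)).inv).aestronglyMeasurable).smul hi.aestronglyMeasurable
  · filter_upwards [hne] with y hy
    have : 0 < ‖x - y‖ := norm_pos_iff.2 (sub_ne_zero.2 hy)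
    rw [norm_smul, norm_smul, norm_inv, Real.norm_of_nonneg (softNorm_nonneg _ _), one_div,
      norm_inv, norm_norm]
    gcongr
    exact norm_le_softNorm _ _
  · filter_upwards [hne] with y hy
    have h0 : ‖x - y‖ ≠ 0 := norm_ne_zero_iff.2 (sub_ne_zero.2 hy)
    have h1 : Tendsto (fun n => softNorm (eps n) (x - y)) atTop (𝓝 ‖x - y‖) := by
      have hcont : Continuous fun ε => softNorm ε (x - y) := by unfold softNorm; fun_prop
      have := (hcont.tendsto 0).comp tendsto_eps
      rwa [softNorm_zero] at this
    rw [one_div]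
    exact (h1.inv₀ h0).smul_const _

/-- The Newtonian potential of an integrable density that is continuous in an open set is
differentiable there. -/
theorem hasFDerivAt_newtonPotential (hΩ : IsOpen Ω) (hi : IntegrableOn ρ Ω)
    (hc : ContinuousOn ρ Ω) {x : E3} (hx : x ∈ Ω) :
    HasFDerivAt (fun x => ∫ y in Ω, (1 / ‖x - y‖) • ρ y)
      (∫ y in Ω, (newtonGrad 0 (x - y)).smulRight (ρ y)) x :=
  hasFDerivAt_of_tendstoLocallyUniformlyOn hΩ (tendstoLocallyUniformlyOn_newtonGrad hΩ hi hc)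
    (fun n x _ => hasFDerivAt_softPotential (eps_pos n) hi x)
    (fun _ hx => tendsto_softPotential hΩ hi hc hx) hx

theorem contDiffOn_newtonPotential (hΩ : IsOpen Ω) (hi : IntegrableOn ρ Ω)
    (hc : ContinuousOn ρ Ω) :
    ContDiffOn ℝ 1 (fun x => ∫ y in Ω, (1 / ‖x - y‖) • ρ y) Ω :=
  contDiffOn_one_of_hasFDerivAt hΩ (fun _ hx => hasFDerivAt_newtonPotential hΩ hi hc hx)
    ((tendstoLocallyUniformlyOn_newtonGrad hΩ hi hc).continuousOn
      (Eventually.of_forall fun n =>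
        (continuous_softPotential_fderiv (eps_pos n) hi).continuousOn).frequently)

end NewtonPotential

/-! ### The regularized kernel as an approximate identity -/

/-- An antiderivative is (y/√(y² + 1))³/3, which grows from 0 to 1/3. This radial integral fixes the
mass of the approximate identity; the form `1 ^ 2` matches `softNorm 1`. -/
lemma integral_sq_mul_inv_sqrt_pow :
    ∫ y in Ioi (0 : ℝ), y ^ 2 * (√(y ^ 2 + 1 ^ 2))⁻¹ ^ 5 = 1 / 3 := by
  have hw : ∀ y : ℝ, 0 < √(y ^ 2 + 1 ^ 2) := fun y => Real.sqrt_pos.2 (by positivity)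
  have hd : ∀ y : ℝ, HasDerivAt (fun y : ℝ => 1 / 3 * (y * (√(y ^ 2 + 1 ^ 2))⁻¹) ^ 3)
      (y ^ 2 * (√(y ^ 2 + 1 ^ 2))⁻¹ ^ 5) y := by
    intro y
    have h1 : HasDerivAt (fun y : ℝ => y ^ 2 + 1 ^ 2) (2 * y) y := by
      simpa using (hasDerivAt_pow 2 y).add_const (1 ^ 2 : ℝ)
    have h2 := (h1.sqrt (by positivity)).inv (hw y).ne'
    have h3 := (((hasDerivAt_id y).mul h2).pow 3).const_mul (1 / 3 : ℝ)
    refine h3.congr_deriv ?_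
    have hs : √(y ^ 2 + 1 ^ 2) ^ 2 = y ^ 2 + 1 ^ 2 := Real.sq_sqrt (by positivity)
    have := hw y
    simp only [id, Pi.mul_apply, Pi.inv_apply, show 3 - 1 = 2 from rfl, Nat.cast_ofNat]
    generalize √(y ^ 2 + 1 ^ 2) = w at *
    field_simp
    linear_combination y ^ 2 * hs
  have hlim : Tendsto (fun y : ℝ => 1 / 3 * (y * (√(y ^ 2 + 1 ^ 2))⁻¹) ^ 3) atTop
      (𝓝 (1 / 3 * 1 ^ 3)) := by
    refine (Tendsto.pow ?_ 3).const_mul _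
    have h1 : Tendsto (fun y : ℝ => 1 - 1 / (y + 1)) atTop (𝓝 (1 - 0)) := by
      refine tendsto_const_nhds.sub ?_
      simp_rw [one_div]
      exact tendsto_inv_atTop_zero.comp (tendsto_atTop_add_const_right _ _ tendsto_id)
    rw [sub_zero] at h1
    refine tendsto_of_tendsto_of_tendsto_of_le_of_le' h1 tendsto_const_nhds ?_ ?_
    · filter_upwards [eventually_gt_atTop 0] with y hy
      have h2 : √(y ^ 2 + 1 ^ 2) ≤ y + 1 := Real.sqrt_le_iff.2 ⟨by positivity, by nlinarith⟩
      have h3 : 1 - 1 / (y + 1) = y / (y + 1) := by field_simp; ring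
      rw [h3, ← div_eq_mul_inv]
      gcongr
    · filter_upwards [eventually_gt_atTop 0] with y hy
      rw [← div_eq_mul_inv, div_le_one (hw y)]
      exact Real.le_sqrt_of_sq_le (by linarith)
  have := integral_Ioi_of_hasDerivAt_of_nonneg' (a := (0 : ℝ)) (fun y _ => hd y)
    (fun y _ => by positivity) hlim
  rw [this]
  norm_num

/-- The weight 3ε²(|z|² + ε²)^(-5/2), minus the Laplacian of the regularized kernel, is 4π times the
rescaling by 1/ε = n + 1 of a radial density of mass one. That density decays like |z|^(-5), faster
than the |z|^(-3) at which approximate identities localize. -/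
lemma tendsto_integral_inv_softNorm_pow_mul {g : E3 → ℝ} (hg : Integrable g) {x : E3}
    (hx : ContinuousAt g x) :
    Tendsto (fun n => ∫ y, (3 * eps n ^ 2 * (softNorm (eps n) (x - y))⁻¹ ^ 5) * g y) atTop
      (𝓝 (4 * Real.pi * g x)) := by
  have hdim : Module.finrank ℝ E3 = 3 := by simp
  have hpi := Real.pi_pos
  set φ : E3 → ℝ := fun z => 3 / (4 * Real.pi) * (softNorm 1 z)⁻¹ ^ 5 with hφ
  have h0 : ∀ z, 0 ≤ φ z := fun z => by
    have := softNorm_nonneg 1 z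
    positivity
  have h1 : ∫ z, φ z = 1 := by
    have := integral_fun_norm_addHaar (volume : Measure E3)
      (fun r : ℝ => 3 / (4 * Real.pi) * (√(r ^ 2 + 1 ^ 2))⁻¹ ^ 5)
    have hv : (volume : Measure E3).real (Metric.ball 0 1) = Real.pi * 4 / 3 := by
      rw [Measure.real, EuclideanSpace.volume_ball_fin_three]
      simp only [ENNReal.ofReal_one, one_pow, one_mul]
      exact ENNReal.toReal_ofReal (by positivity)
    simp only [hφ, softNorm]
    rw [this, hv, hdim]
    have h2 : ∀ y : ℝ, y ^ (3 - 1) • (3 / (4 * Real.pi) * (√(y ^ 2 + 1 ^ 2))⁻¹ ^ 5)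
        = 3 / (4 * Real.pi) * (y ^ 2 * (√(y ^ 2 + 1 ^ 2))⁻¹ ^ 5) := fun y => by
      simp only [smul_eq_mul, Nat.add_one_sub_one]; ring
    simp_rw [h2]
    rw [integral_const_mul, integral_sq_mul_inv_sqrt_pow]
    simp only [smul_eq_mul, nsmul_eq_mul]
    field_simp
    norm_num
  have h2 : Tendsto (fun z => ‖z‖ ^ Module.finrank ℝ E3 * φ z) (Bornology.cobounded E3) (𝓝 0) := by
    rw [hdim]
    have h3 : Tendsto (fun z : E3 => 3 / (4 * Real.pi) * ‖z‖⁻¹ ^ 2) (Bornology.cobounded E3)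
        (𝓝 0) := by
      have := ((tendsto_inv_atTop_zero.comp (tendsto_norm_cobounded_atTop (E := E3))).pow
        2).const_mul (3 / (4 * Real.pi))
      simpa using this
    refine squeeze_zero (fun z => mul_nonneg (by positivity) (h0 z)) (fun z => ?_) h3
    rcases eq_or_ne z 0 with rfl | hz
    · simp
    have hr : 0 < ‖z‖ := norm_pos_iff.2 hz
    have hle := norm_le_softNorm 1 z
    have hw := softNorm_pos one_pos z
    calc ‖z‖ ^ 3 * φ z = 3 / (4 * Real.pi) * (‖z‖ ^ 3 * (softNorm 1 z)⁻¹ ^ 5) := by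
          rw [hφ]; ring
      _ ≤ 3 / (4 * Real.pi) * (‖z‖ ^ 3 * ‖z‖⁻¹ ^ 5) := by gcongr
      _ = _ := by field_simp
  have h3 := tendsto_integral_comp_smul_smul_of_integrable' h0 h1 h2 hg hx
  have h4 : Tendsto (fun n : ℕ => (n : ℝ) + 1) atTop atTop :=
    tendsto_atTop_add_const_right _ _ tendsto_natCast_atTop_atTop
  have h5 := (h3.comp h4).const_mul (4 * Real.pi)
  refine h5.congr fun n => ?_
  simp only [Function.comp]
  rw [← integral_const_mul]
  congr 1
  ext y
  have hn : (0 : ℝ) < n + 1 := by positivity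
  have h6 : softNorm 1 (((n : ℝ) + 1) • (x - y)) = (n + 1) * softNorm (eps n) (x - y) := by
    unfold softNorm eps
    rw [norm_smul, Real.norm_of_nonneg hn.le]
    have : (((n : ℝ) + 1) * ‖x - y‖) ^ 2 + 1 ^ 2
        = (n + 1) ^ 2 * (‖x - y‖ ^ 2 + (1 / ((n : ℝ) + 1)) ^ 2) := by field_simp
    rw [this, Real.sqrt_mul (by positivity), Real.sqrt_sq hn.le]
  have h7 := softNorm_pos (eps_pos n) (x - y)
  simp only [hφ]
  rw [hdim, h6, smul_eq_mul]
  unfold eps at *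
  field_simp

/-! ### Second derivatives of Newtonian potentials -/

section

variable {Ω : Set E3} {u : E3 → ℝ}

/-- The regularized kernel is smooth, so the derivative moves from u to the kernel. The minus sign
of the integration by parts cancels the one from differentiating x − y in y, and u is integrated
against the Hessian of the kernel. -/
lemma setIntegral_newtonGrad_mul_fderiv {ε : ℝ} (hε : 0 < ε) (hΩ : IsOpen Ω)
    (hb : Bornology.IsBounded Ω) (hu : ContDiffOn ℝ 1 u Ω) (hc : ContinuousOn u (closure Ω))
    (h0 : ∀ x ∈ frontier Ω, u x = 0) (x e d : E3)
    (hi : IntegrableOn (fun y => fderiv ℝ u y d) Ω) :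
    ∫ y in Ω, newtonGrad ε (x - y) e * fderiv ℝ u y d =
      ∫ y in Ω, u y * (3 * (softNorm ε (x - y))⁻¹ ^ 5 * inner ℝ (x - y) e * inner ℝ (x - y) d
        - (softNorm ε (x - y))⁻¹ ^ 3 * inner ℝ e d) := by
  have hφ : ContDiff ℝ 1 fun y => newtonGrad ε (x - y) e :=
    (contDiff_newtonGrad_apply hε e).comp (contDiff_const.sub contDiff_id)
  have h := setIntegral_fderiv_mul_eq_neg volume hΩ hb hu hc h0 d hi hφ
  simp_rw [mul_comm (fderiv ℝ u _ d)] at h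
  rw [h, ← integral_neg]
  congr 1
  ext y
  have h1 := (hasFDerivAt_newtonGrad_apply hε e (x - y)).comp y ((hasFDerivAt_id y).const_sub x)
  have h2 : fderiv ℝ (fun y => newtonGrad ε (x - y) e) y = _ := h1.fderiv
  rw [h2]
  simp [inner_sub_left]
  ring

lemma tendsto_setIntegral_newtonGrad_mul {ρ : E3 → ℝ} (hΩ : IsOpen Ω) (hi : IntegrableOn ρ Ω)
    (hc : ContinuousOn ρ Ω) {x : E3} (hx : x ∈ Ω) (e : E3) :
    Tendsto (fun n => ∫ y in Ω, newtonGrad (eps n) (x - y) e * ρ y) atTop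
      (𝓝 (∫ y in Ω, newtonGrad 0 (x - y) e * ρ y)) := by
  have h := (tendstoLocallyUniformlyOn_newtonGrad hΩ hi hc).tendsto_at hx
  have h1 := ((ContinuousLinearMap.apply ℝ ℝ e).continuous.tendsto _).comp h
  have e1 : ∀ n, (∫ y in Ω, (newtonGrad (eps n) (x - y)).smulRight (ρ y)) e
      = ∫ y in Ω, newtonGrad (eps n) (x - y) e * ρ y := fun n => by
    rw [ContinuousLinearMap.integral_apply
      (integrableOn_newtonGrad_smulRight_of_pos (eps_pos n) hi x)]
    rfl
  have e2 : (∫ y in Ω, (newtonGrad 0 (x - y)).smulRight (ρ y)) e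
      = ∫ y in Ω, newtonGrad 0 (x - y) e * ρ y := by
    rw [ContinuousLinearMap.integral_apply (integrableOn_newtonGrad_smulRight hΩ hi hc hx)]
    rfl
  rw [← e2]
  simp_rw [← e1]
  exact h1

variable (hΩ : IsOpen Ω) (hb : Bornology.IsBounded Ω) (hu : ContDiffOn ℝ 1 u Ω)
  (hc : ContinuousOn u (closure Ω)) (h0 : ∀ x ∈ frontier Ω, u x = 0)
  (hi : ∀ d, IntegrableOn (fun y => fderiv ℝ u y d) Ω)
include hΩ hb hu hc h0 hi

/-- The second derivatives of the Newtonian potential of `u` are symmetric. -/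
theorem setIntegral_newtonGrad_mul_fderiv_comm {x : E3} (hx : x ∈ Ω) (e d : E3) :
    ∫ y in Ω, newtonGrad 0 (x - y) e * fderiv ℝ u y d =
      ∫ y in Ω, newtonGrad 0 (x - y) d * fderiv ℝ u y e := by
  have hcd : ∀ d, ContinuousOn (fun y => fderiv ℝ u y d) Ω := fun d =>
    (hu.continuousOn_fderiv_of_isOpen hΩ le_rfl).clm_apply continuousOn_const
  -- For each positive ε both integrals equal that of u against the kernel's Hessian, which is
  -- symmetric in e and d.
  refine tendsto_nhds_unique (tendsto_setIntegral_newtonGrad_mul hΩ (hi d) (hcd d) hx e) ?_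
  refine (tendsto_setIntegral_newtonGrad_mul hΩ (hi e) (hcd e) hx d).congr fun n => ?_
  rw [setIntegral_newtonGrad_mul_fderiv (eps_pos n) hΩ hb hu hc h0 x e d (hi d),
    setIntegral_newtonGrad_mul_fderiv (eps_pos n) hΩ hb hu hc h0 x d e (hi e)]
  congr 1
  ext y
  rw [real_inner_comm e d]
  ring

/-- Poisson's equation: the Laplacian of the Newtonian potential of `u` is `-4πu`. -/
theorem sum_setIntegral_newtonGrad_mul_fderiv {x : E3} (hx : x ∈ Ω) :
    ∑ i, ∫ y in Ω, newtonGrad 0 (x - y) (EuclideanSpace.single i 1) *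
      fderiv ℝ u y (EuclideanSpace.single i 1) = -(4 * Real.pi * u x) := by
  have hcd : ∀ d, ContinuousOn (fun y => fderiv ℝ u y d) Ω := fun d =>
    (hu.continuousOn_fderiv_of_isOpen hΩ le_rfl).clm_apply continuousOn_const
  have hui : IntegrableOn u Ω :=
    (hc.integrableOn_compact hb.isCompact_closure).mono_set subset_closure
  have l1 := tendsto_finsetSum (Finset.univ : Finset (Fin 3)) fun i _ =>
    tendsto_setIntegral_newtonGrad_mul hΩ (hi (EuclideanSpace.single i 1)) (hcd _) hx
      (EuclideanSpace.single i 1)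
  have hcx : ContinuousAt (Ω.indicator u) x := by
    refine ((hu.continuousOn x hx).continuousAt (hΩ.mem_nhds hx)).congr ?_
    filter_upwards [hΩ.mem_nhds hx] with y hy
    rw [indicator_of_mem hy]
  have l2 := (tendsto_integral_inv_softNorm_pow_mul
    ((integrable_indicator_iff hΩ.measurableSet).2 hui) hcx).neg
  rw [indicator_of_mem hx] at l2
  refine tendsto_nhds_unique l1 (l2.congr fun n => ?_)
  have hw : Continuous fun y => (softNorm (eps n) (x - y))⁻¹ :=
    ((continuous_softNorm _).comp (continuous_const.sub continuous_id)).inv₀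
      fun y => (softNorm_pos (eps_pos n) _).ne'
  have hind : ∀ y, (3 * eps n ^ 2 * (softNorm (eps n) (x - y))⁻¹ ^ 5) * Ω.indicator u y
      = Ω.indicator (fun y => (3 * eps n ^ 2 * (softNorm (eps n) (x - y))⁻¹ ^ 5) * u y) y := by
    intro y
    by_cases hy : y ∈ Ω <;> simp [hy]
  simp_rw [hind]
  rw [integral_indicator hΩ.measurableSet, ← integral_neg]
  simp_rw [fun i => setIntegral_newtonGrad_mul_fderiv (eps_pos n) hΩ hb hu hc h0 x
    (EuclideanSpace.single i 1) (EuclideanSpace.single i 1) (hi (EuclideanSpace.single i 1))]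
  -- With w the regularized norm of z = x − y, the trace of the Hessian is 3w⁻⁵|z|² − 3w⁻³ =
  -- −3ε²w⁻⁵, because |z|² = w² − ε².
  rw [← integral_finsetSum]
  · congr 1
    ext y
    have hsq := softNorm_sq (eps n) (x - y)
    have hpos := softNorm_pos (eps_pos n) (x - y)
    rw [EuclideanSpace.norm_sq_eq] at hsq
    simp only [Fin.sum_univ_three, EuclideanSpace.inner_single_right, Real.norm_eq_abs, sq_abs,
      PiLp.single_apply] at hsq ⊢
    simp
    generalize softNorm (eps n) (x - y) = w at *
    simp at hsq
    field_simp
    linear_combination (3 * u y) * hsq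
  · intro i _
    refine ((hc.mul (Continuous.continuousOn ?_)).integrableOn_compact
      hb.isCompact_closure).mono_set subset_closure
    fun_prop

end

/-! ### The Helmholtz decomposition -/

/-- The curl of a vector field as a linear function of its derivative. -/
noncomputable def curlCLM : (E3 →L[ℝ] E3) →L[ℝ] E3 :=
  LinearMap.toContinuousLinearMap
    { toFun := fun L =>
        !₂[L (EuclideanSpace.single 1 1) 2 - L (EuclideanSpace.single 2 1) 1,
          L (EuclideanSpace.single 2 1) 0 - L (EuclideanSpace.single 0 1) 2,
          L (EuclideanSpace.single 0 1) 1 - L (EuclideanSpace.single 1 1) 0]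
      map_add' := fun L L' => by ext i; fin_cases i <;> simp <;> ring
      map_smul' := fun c L => by ext i; fin_cases i <;> simp <;> ring }

/-- The divergence of a vector field as a linear function of its derivative. -/
noncomputable def divCLM : (E3 →L[ℝ] E3) →L[ℝ] ℝ :=
  LinearMap.toContinuousLinearMap
    { toFun := fun L => ∑ i, L (EuclideanSpace.single i 1) i
      map_add' := fun L L' => by simp [Finset.sum_add_distrib]
      map_smul' := fun c L => by simp [Finset.mul_sum] }

/-- Factored through continuous linear maps, curl and divergence inherit continuity and
integrability from the derivative and commute with Bochner integrals. -/
lemma curl_eq (u : E3 → E3) (x : E3) : curl u x = curlCLM (fderiv ℝ u x) := rfl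

lemma div_eq (u : E3 → E3) (x : E3) : div u x = divCLM (fderiv ℝ u x) := rfl

lemma gradient_apply (φ : E3 → ℝ) (x : E3) (i : Fin 3) :
    gradient φ x i = fderiv ℝ φ x (EuclideanSpace.single i 1) := by
  have : inner ℝ (gradient φ x) (EuclideanSpace.single i 1)
      = fderiv ℝ φ x (EuclideanSpace.single i 1) := by
    rw [gradient, InnerProductSpace.toDual_symm_apply]
  rw [← this, EuclideanSpace.inner_single_right]
  simp

/-- The surface measure lives on the frontier, where s = 0; the value of the normal field is
immaterial. -/
lemma surface_vectorPotential_eq_zero {Ω : Set E3} {s : E3 → E3} (h0 : ∀ x ∈ frontier Ω, s x = 0)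
    (x : E3) : (fun y => cross ((1 / ‖x - y‖) • s y) (outwardNormal Ω y))
      =ᵐ[surfaceMeasure Ω] fun _ => 0 := by
  rw [surfaceMeasure, EventuallyEq, ae_restrict_iff' isClosed_frontier.measurableSet]
  refine Eventually.of_forall fun y hy => ?_
  rw [h0 y hy]
  simp [cross]

lemma surface_scalarPotential_eq_zero {Ω : Set E3} {s : E3 → E3} (h0 : ∀ x ∈ frontier Ω, s x = 0)
    (x : E3) : (fun y => inner ℝ ((1 / ‖x - y‖) • s y) (outwardNormal Ω y))
      =ᵐ[surfaceMeasure Ω] fun _ => 0 := by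
  rw [surfaceMeasure, EventuallyEq, ae_restrict_iff' isClosed_frontier.measurableSet]
  refine Eventually.of_forall fun y hy => ?_
  rw [h0 y hy]
  simp

section

variable {Ω : Set E3} {s : E3 → E3}

lemma vectorPotential_eq (h0 : ∀ x ∈ frontier Ω, s x = 0) :
    vectorPotential Ω s
      = fun x => (1 / (4 * Real.pi)) • ∫ y in Ω, (1 / ‖x - y‖) • curl s y := by
  ext1 x
  rw [vectorPotential, integral_congr_ae (surface_vectorPotential_eq_zero h0 x)]
  simp

lemma scalarPotential_eq (h0 : ∀ x ∈ frontier Ω, s x = 0) :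
    scalarPotential Ω s
      = fun x => (1 / (4 * Real.pi)) • ∫ y in Ω, (1 / ‖x - y‖) • div s y := by
  ext1 x
  rw [scalarPotential, integral_congr_ae (surface_scalarPotential_eq_zero h0 x)]
  simp

lemma integrableOn_curl (hi : IntegrableOn (fderiv ℝ s) Ω) : IntegrableOn (curl s) Ω :=
  curlCLM.integrable_comp hi

lemma integrableOn_div (hi : IntegrableOn (fderiv ℝ s) Ω) : IntegrableOn (div s) Ω :=
  divCLM.integrable_comp hi

lemma continuousOn_curl (hΩ : IsOpen Ω) (hs : ContDiffOn ℝ 1 s Ω) : ContinuousOn (curl s) Ω :=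
  curlCLM.continuous.comp_continuousOn (hs.continuousOn_fderiv_of_isOpen hΩ le_rfl)

lemma continuousOn_div (hΩ : IsOpen Ω) (hs : ContDiffOn ℝ 1 s Ω) : ContinuousOn (div s) Ω :=
  divCLM.continuous.comp_continuousOn (hs.continuousOn_fderiv_of_isOpen hΩ le_rfl)

lemma potentialsConverge (hΩ : IsOpen Ω) (hs : ContDiffOn ℝ 1 s Ω)
    (h0 : ∀ x ∈ frontier Ω, s x = 0) (hi : IntegrableOn (fderiv ℝ s) Ω) {x : E3} (hx : x ∈ Ω) :
    PotentialsConverge Ω s x :=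
  ⟨integrableOn_newtonPotential hΩ (integrableOn_curl hi) (continuousOn_curl hΩ hs) hx,
    (integrable_zero _ _ _).congr (surface_vectorPotential_eq_zero h0 x).symm,
    integrableOn_newtonPotential hΩ (integrableOn_div hi) (continuousOn_div hΩ hs) hx,
    (integrable_zero _ _ _).congr (surface_scalarPotential_eq_zero h0 x).symm⟩

lemma contDiffOn_vectorPotential (hΩ : IsOpen Ω) (hs : ContDiffOn ℝ 1 s Ω)
    (h0 : ∀ x ∈ frontier Ω, s x = 0) (hi : IntegrableOn (fderiv ℝ s) Ω) :
    ContDiffOn ℝ 1 (vectorPotential Ω s) Ω := by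
  rw [vectorPotential_eq h0]
  exact (contDiffOn_const (c := (1 / (4 * Real.pi) : ℝ))).smul
    (contDiffOn_newtonPotential hΩ (integrableOn_curl hi) (continuousOn_curl hΩ hs))

lemma contDiffOn_scalarPotential (hΩ : IsOpen Ω) (hs : ContDiffOn ℝ 1 s Ω)
    (h0 : ∀ x ∈ frontier Ω, s x = 0) (hi : IntegrableOn (fderiv ℝ s) Ω) :
    ContDiffOn ℝ 1 (scalarPotential Ω s) Ω := by
  rw [scalarPotential_eq h0]
  exact (contDiffOn_const (c := (1 / (4 * Real.pi) : ℝ))).smul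
    (contDiffOn_newtonPotential hΩ (integrableOn_div hi) (continuousOn_div hΩ hs))

/-- A vector field that vanishes on the boundary is the curl of its vector potential minus the
gradient of its scalar potential. -/
theorem curl_vectorPotential_sub_gradient_scalarPotential (hΩ : IsOpen Ω)
    (hb : Bornology.IsBounded Ω) (hs : ContDiffOn ℝ 1 s Ω) (hc : ContinuousOn s (closure Ω))
    (h0 : ∀ x ∈ frontier Ω, s x = 0) (hi : IntegrableOn (fderiv ℝ s) Ω) {x : E3} (hx : x ∈ Ω) :
    curl (vectorPotential Ω s) x - gradient (scalarPotential Ω s) x = s x := by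
  set e : Fin 3 → E3 := fun i => EuclideanSpace.single i 1 with he
  -- `J i j k` is ∂ᵢ of the unnormalized Newtonian potential of ∂ⱼsₖ. Symmetry in i, j and the trace
  -- formula reduce the decomposition to linear algebra in these numbers.
  set J : Fin 3 → Fin 3 → Fin 3 → ℝ := fun i j k =>
    ∫ y in Ω, newtonGrad 0 (x - y) (e i) * partialD j s y k with hJ
  have hcd : ∀ j k, ContinuousOn (fun y => partialD j s y k) Ω := fun j k =>
    (EuclideanSpace.proj k : E3 →L[ℝ] ℝ).continuous.comp_continuousOn
      ((hs.continuousOn_fderiv_of_isOpen hΩ le_rfl).clm_apply continuousOn_const)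
  have hid : ∀ j k, IntegrableOn (fun y => partialD j s y k) Ω := fun j k =>
    (EuclideanSpace.proj k : E3 →L[ℝ] ℝ).integrable_comp
      ((ContinuousLinearMap.apply ℝ E3 (e j)).integrable_comp hi)
  have hJi : ∀ i j k, IntegrableOn (fun y => newtonGrad 0 (x - y) (e i) * partialD j s y k) Ω :=
    fun i j k => (ContinuousLinearMap.apply ℝ ℝ (e i)).integrable_comp
      (integrableOn_newtonGrad_smulRight hΩ (hid j k) (hcd j k) hx)
  -- the components of `s`
  have hcomp : ∀ k, ∀ y ∈ Ω, ∀ d, fderiv ℝ (fun z => s z k) y d = fderiv ℝ s y d k := by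
    intro k y hy d
    have h1 := ((hs.differentiableOn one_ne_zero y hy).differentiableAt
      (hΩ.mem_nhds hy)).hasFDerivAt
    have h2 := (EuclideanSpace.proj k : E3 →L[ℝ] ℝ).hasFDerivAt.comp y h1
    have h3 : fderiv ℝ (fun z => s z k) y = _ := h2.fderiv
    rw [h3]
    rfl
  have hJ' : ∀ i j k, J i j k
      = ∫ y in Ω, newtonGrad 0 (x - y) (e i) * fderiv ℝ (fun z => s z k) y (e j) :=
    fun i j k => setIntegral_congr_fun hΩ.measurableSet fun y hy => by
      simp only [hcomp k y hy]; rfl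
  have hsk : ∀ k, ContDiffOn ℝ 1 (fun z => s z k) Ω := fun k =>
    (EuclideanSpace.proj k : E3 →L[ℝ] ℝ).contDiff.comp_contDiffOn hs
  have hck : ∀ k, ContinuousOn (fun z => s z k) (closure Ω) := fun k =>
    (EuclideanSpace.proj k : E3 →L[ℝ] ℝ).continuous.comp_continuousOn hc
  have h0k : ∀ k, ∀ z ∈ frontier Ω, s z k = 0 := fun k z hz => by rw [h0 z hz]; rfl
  have hik : ∀ k d, IntegrableOn (fun y => fderiv ℝ (fun z => s z k) y d) Ω := by
    intro k d
    have : IntegrableOn (fun y => fderiv ℝ s y d k) Ω :=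
      (EuclideanSpace.proj k : E3 →L[ℝ] ℝ).integrable_comp
      ((ContinuousLinearMap.apply ℝ E3 d).integrable_comp hi)
    exact this.congr_fun (fun y hy => (hcomp k y hy d).symm) hΩ.measurableSet
  have hsymm : ∀ i j k, J i j k = J j i k := fun i j k => by
    rw [hJ', hJ']
    exact setIntegral_newtonGrad_mul_fderiv_comm hΩ hb (hsk k) (hck k) (h0k k) (hik k) hx _ _
  have hsum : ∀ k, J 0 0 k + J 1 1 k + J 2 2 k = -(4 * Real.pi * s x k) := fun k => by
    rw [hJ', hJ', hJ', ← sum_setIntegral_newtonGrad_mul_fderiv hΩ hb (hsk k) (hck k) (h0k k)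
      (hik k) hx, Fin.sum_univ_three]
  -- the derivatives of the potentials
  have hA := (hasFDerivAt_newtonPotential hΩ (integrableOn_curl hi)
    (continuousOn_curl hΩ hs) hx).const_smul (1 / (4 * Real.pi))
  have hB := (hasFDerivAt_newtonPotential hΩ (integrableOn_div hi)
    (continuousOn_div hΩ hs) hx).const_smul (1 / (4 * Real.pi))
  have hA' : ∀ i k, partialD i (vectorPotential Ω s) x k
      = 1 / (4 * Real.pi) * ∫ y in Ω, newtonGrad 0 (x - y) (e i) * curl s y k := by
    intro i k
    have hint := integrableOn_newtonGrad_smulRight hΩ (integrableOn_curl hi)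
      (continuousOn_curl hΩ hs) hx
    have hint' := (ContinuousLinearMap.apply ℝ E3 (e i)).integrable_comp hint
    have h1 : fderiv ℝ (vectorPotential Ω s) x = (1 / (4 * Real.pi)) •
        ∫ y in Ω, (newtonGrad 0 (x - y)).smulRight (curl s y) := by
      rw [vectorPotential_eq h0]; exact hA.fderiv
    rw [partialD, h1]
    simp only [smul_apply, PiLp.smul_apply, smul_eq_mul]
    rw [ContinuousLinearMap.integral_apply hint]
    exact congrArg _ ((EuclideanSpace.proj k : E3 →L[ℝ] ℝ).integral_comp_comm hint').symm
  have hB' : ∀ i, fderiv ℝ (scalarPotential Ω s) x (e i)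
      = 1 / (4 * Real.pi) * ∫ y in Ω, newtonGrad 0 (x - y) (e i) * div s y := by
    intro i
    have hint := integrableOn_newtonGrad_smulRight hΩ (integrableOn_div hi)
      (continuousOn_div hΩ hs) hx
    have h1 : fderiv ℝ (scalarPotential Ω s) x = (1 / (4 * Real.pi)) •
        ∫ y in Ω, (newtonGrad 0 (x - y)).smulRight (div s y) := by
      rw [scalarPotential_eq h0]; exact hB.fderiv
    rw [h1]
    simp only [smul_apply, smul_eq_mul]
    rw [ContinuousLinearMap.integral_apply hint]
    rfl
  have hdiv : ∀ i, ∫ y in Ω, newtonGrad 0 (x - y) (e i) * div s y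
      = J i 0 0 + J i 1 1 + J i 2 2 := by
    intro i
    simp only [div, Fin.sum_univ_three, mul_add]
    exact (integral_add ((hJi i 0 0).add (hJi i 1 1)) (hJi i 2 2)).trans
      (congrArg (· + J i 2 2) (integral_add (hJi i 0 0) (hJi i 1 1)))
  have hcurl0 : ∀ i, ∫ y in Ω, newtonGrad 0 (x - y) (e i) * curl s y 0 = J i 1 2 - J i 2 1 := by
    intro i
    rw [hJ, ← integral_sub (hJi i 1 2) (hJi i 2 1)]
    simp [curl, mul_sub]
  have hcurl1 : ∀ i, ∫ y in Ω, newtonGrad 0 (x - y) (e i) * curl s y 1 = J i 2 0 - J i 0 2 := by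
    intro i
    rw [hJ, ← integral_sub (hJi i 2 0) (hJi i 0 2)]
    simp [curl, mul_sub]
  have hcurl2 : ∀ i, ∫ y in Ω, newtonGrad 0 (x - y) (e i) * curl s y 2 = J i 0 1 - J i 1 0 := by
    intro i
    rw [hJ, ← integral_sub (hJi i 0 1) (hJi i 1 0)]
    simp [curl, mul_sub]
  have hpi := Real.pi_pos
  have hs0 : ∀ k, s x k = -(1 / (4 * Real.pi)) * (J 0 0 k + J 1 1 k + J 2 2 k) := fun k => by
    rw [hsum]; field_simp
  ext k
  have hg := gradient_apply (scalarPotential Ω s) x k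
  rw [PiLp.sub_apply, hg, hs0, hB' k, hdiv]
  have c0 : ∀ u : E3 → E3, curl u x 0 = partialD 1 u x 2 - partialD 2 u x 1 := fun u => rfl
  have c1 : ∀ u : E3 → E3, curl u x 1 = partialD 2 u x 0 - partialD 0 u x 2 := fun u => rfl
  have c2 : ∀ u : E3 → E3, curl u x 2 = partialD 0 u x 1 - partialD 1 u x 0 := fun u => rfl
  -- In each component the curl of the vector potential contributes two mixed terms that, once their
  -- first two indices are swapped, cancel against the gradient of the scalar potential; the trace
  -- of J remains.
  fin_cases k
  · simp only [Fin.zero_eta, c0, hA', hcurl1, hcurl2]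
    rw [hsymm 1 0 1, hsymm 2 0 2]
    ring
  · simp only [Fin.mk_one, c1, hA', hcurl0, hcurl2]
    rw [hsymm 2 1 2, hsymm 0 1 0]
    ring
  · simp only [Fin.reduceFinMk, c2, hA', hcurl0, hcurl1]
    rw [hsymm 0 2 0, hsymm 1 2 1]
    ring

end

/-! ### Means of families of differentiable functions -/

section

variable {X : Type*} [MeasurableSpace X] {P : Measure X}
  {F : Type*} [NormedAddCommGroup F] [NormedSpace ℝ F]

/-- A directional derivative is a limit of difference quotients along a sequence of steps. The shift
by N keeps all points x + e/(n+N+1) in U, where measurability is known. -/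
lemma aestronglyMeasurable_fderiv_apply {E : Type*} [NormedAddCommGroup E] [NormedSpace ℝ E]
    {U : Set E} (hU : IsOpen U) {h : E → X → F} (hm : ∀ x ∈ U, AEStronglyMeasurable (h x) P)
    {x : E} (hx : x ∈ U) (hd : ∀ ω, DifferentiableAt ℝ (fun y => h y ω) x) (e : E) :
    AEStronglyMeasurable (fun ω => fderiv ℝ (fun y => h y ω) x e) P := by
  have h1 : Tendsto (fun n : ℕ => x + ((n : ℝ) + 1)⁻¹ • e) atTop (𝓝 x) := by
    have h2 : Tendsto (fun n : ℕ => ((n : ℝ) + 1)⁻¹) atTop (𝓝 0) := by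
      simpa using tendsto_one_div_add_atTop_nhds_zero_nat (𝕜 := ℝ)
    simpa using (h2.smul_const e).const_add x
  obtain ⟨N, hN⟩ := eventually_atTop.1 (h1.eventually (hU.mem_nhds hx))
  have hc : Tendsto (fun n : ℕ => (((n + N : ℕ) : ℝ) + 1)) atTop atTop :=
    tendsto_atTop_add_const_right _ _
      (tendsto_natCast_atTop_atTop.comp (tendsto_add_atTop_nat N))
  refine aestronglyMeasurable_of_tendsto_ae atTop
    (f := fun (n : ℕ) ω => (((n + N : ℕ) : ℝ) + 1) •
      (h (x + (((n + N : ℕ) : ℝ) + 1)⁻¹ • e) ω - h x ω)) (fun n => ?_)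
    (Eventually.of_forall fun ω => (hd ω).hasFDerivAt.lim e
      (tendsto_norm_atTop_atTop.comp hc))
  exact ((hm _ (hN _ (Nat.le_add_left _ _))).sub (hm x hx)).const_smul _

/-- Reduces measurability of the operator-valued derivative to that of three directional
derivatives. -/
lemma clm_eq_sum_smulRight (L : E3 →L[ℝ] F) :
    L = ∑ i, (EuclideanSpace.proj i : E3 →L[ℝ] ℝ).smulRight (L (EuclideanSpace.single i 1)) := by
  ext x
  have hx : x = ∑ i, x i • (EuclideanSpace.single i (1 : ℝ) : E3) := by
    ext j; fin_cases j <;> simp [Fin.sum_univ_three]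
  conv_lhs => rw [hx]
  simp [Fin.sum_univ_three]

lemma aestronglyMeasurable_fderiv {U : Set E3} (hU : IsOpen U) {h : E3 → X → F}
    (hm : ∀ x ∈ U, AEStronglyMeasurable (h x) P) {x : E3} (hx : x ∈ U)
    (hd : ∀ ω, DifferentiableAt ℝ (fun y => h y ω) x) :
    AEStronglyMeasurable (fun ω => fderiv ℝ (fun y => h y ω) x) P := by
  have : (fun ω => fderiv ℝ (fun y => h y ω) x) = fun ω => ∑ i,
      ContinuousLinearMap.smulRightL ℝ E3 F (EuclideanSpace.proj i)
        (fderiv ℝ (fun y => h y ω) x (EuclideanSpace.single i 1)) := by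
    ext1 ω
    exact clm_eq_sum_smulRight _
  rw [this]
  exact Finset.aestronglyMeasurable_fun_sum _ fun i _ =>
    (ContinuousLinearMap.continuous _).comp_aestronglyMeasurable
      (aestronglyMeasurable_fderiv_apply hU hm hx hd _)

/-- A family of `C¹` functions, depending measurably on a parameter, that is bounded with its
derivatives by the product of an integrable and a continuous function. -/
structure IsDominatedFamily (P : Measure X) (U : Set E3) (h : E3 → X → F) (A : X → ℝ)
    (G : E3 → ℝ) : Prop where
  isOpen : IsOpen U
  meas : ∀ x ∈ U, AEStronglyMeasurable (h x) P
  contDiffOn : ∀ ω, ContDiffOn ℝ 1 (fun y => h y ω) U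
  nonneg : ∀ ω, 0 ≤ A ω
  integrable_bound : Integrable A P
  continuousOn_bound : ContinuousOn G U
  le_bound : ∀ x ∈ U, ∀ ω, ‖h x ω‖ ≤ A ω * G x
  fderiv_le_bound : ∀ x ∈ U, ∀ ω, ‖fderiv ℝ (fun y => h y ω) x‖ ≤ A ω * G x

namespace IsDominatedFamily

variable {U : Set E3} {h : E3 → X → F} {A : X → ℝ} {G : E3 → ℝ}

lemma differentiableAt (H : IsDominatedFamily P U h A G) {x : E3} (hx : x ∈ U) (ω : X) :
    DifferentiableAt ℝ (fun y => h y ω) x :=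
  ((H.contDiffOn ω).differentiableOn one_ne_zero x hx).differentiableAt (H.isOpen.mem_nhds hx)

lemma integrable (H : IsDominatedFamily P U h A G) {x : E3} (hx : x ∈ U) :
    Integrable (h x) P :=
  (H.integrable_bound.mul_const (G x)).mono' (H.meas x hx)
    (Eventually.of_forall (H.le_bound x hx))

lemma meas_fderiv (H : IsDominatedFamily P U h A G) {x : E3} (hx : x ∈ U) :
    AEStronglyMeasurable (fun ω => fderiv ℝ (fun y => h y ω) x) P :=
  aestronglyMeasurable_fderiv H.isOpen H.meas hx (H.differentiableAt hx)

lemma integrable_fderiv (H : IsDominatedFamily P U h A G) {x : E3} (hx : x ∈ U) :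
    Integrable (fun ω => fderiv ℝ (fun y => h y ω) x) P :=
  (H.integrable_bound.mul_const (G x)).mono' (H.meas_fderiv hx)
    (Eventually.of_forall (H.fderiv_le_bound x hx))

/-- Continuity of G at x₀ turns the pointwise bound into a single integrable function dominating the
derivatives at all nearby points, as differentiation under the integral requires. -/
lemma eventually_le (H : IsDominatedFamily P U h A G) {x₀ : E3} (hx₀ : x₀ ∈ U) :
    ∀ᶠ x in 𝓝 x₀, x ∈ U ∧ ∀ ω, ‖fderiv ℝ (fun y => h y ω) x‖ ≤ A ω * (G x₀ + 1) := by
  have h1 : ∀ᶠ x in 𝓝 x₀, G x < G x₀ + 1 :=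
    (H.continuousOn_bound.continuousAt (H.isOpen.mem_nhds hx₀)).eventually
      (gt_mem_nhds (lt_add_one _))
  filter_upwards [h1, H.isOpen.mem_nhds hx₀] with x hx hxU
  exact ⟨hxU, fun ω => (H.fderiv_le_bound x hxU ω).trans
    (mul_le_mul_of_nonneg_left hx.le (H.nonneg ω))⟩

lemma hasFDerivAt (H : IsDominatedFamily P U h A G) {x : E3} (hx : x ∈ U) :
    HasFDerivAt (fun y => ∫ ω, h y ω ∂P) (∫ ω, fderiv ℝ (fun y => h y ω) x ∂P) x :=
  hasFDerivAt_integral_of_dominated_of_fderiv_le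
    (F' := fun x ω => fderiv ℝ (fun y => h y ω) x) (H.eventually_le hx)
    ((H.isOpen.eventually_mem hx).mono H.meas) (H.integrable hx) (H.meas_fderiv hx)
    (Eventually.of_forall fun ω _ hy => hy.2 ω) (H.integrable_bound.mul_const (G x + 1))
    (Eventually.of_forall fun ω _ hy => (H.differentiableAt hy.1 ω).hasFDerivAt)

lemma fderiv_integral (H : IsDominatedFamily P U h A G) {x : E3} (hx : x ∈ U) :
    fderiv ℝ (fun y => ∫ ω, h y ω ∂P) x = ∫ ω, fderiv ℝ (fun y => h y ω) x ∂P :=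
  (H.hasFDerivAt hx).fderiv

lemma contDiffOn_integral (H : IsDominatedFamily P U h A G) :
    ContDiffOn ℝ 1 (fun y => ∫ ω, h y ω ∂P) U := by
  refine contDiffOn_one_of_hasFDerivAt H.isOpen (fun x hx => H.hasFDerivAt hx) fun x hx => ?_
  refine (continuousAt_of_dominated (bound := fun ω => A ω * (G x + 1)) ?_ ?_
    (H.integrable_bound.mul_const _) (Eventually.of_forall fun ω => ?_)).continuousWithinAt
  · exact (H.isOpen.eventually_mem hx).mono fun _ hy => H.meas_fderiv hy
  · exact (H.eventually_le hx).mono fun _ hy => Eventually.of_forall hy.2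
  · exact ((H.contDiffOn ω).continuousOn_fderiv_of_isOpen H.isOpen le_rfl).continuousAt
      (H.isOpen.mem_nhds hx)

lemma norm_fderiv_integral_le (H : IsDominatedFamily P U h A G) {x : E3} (hx : x ∈ U) :
    ‖fderiv ℝ (fun y => ∫ ω, h y ω ∂P) x‖ ≤ (∫ ω, A ω ∂P) * G x := by
  rw [H.fderiv_integral hx, ← integral_mul_const]
  exact norm_integral_le_of_norm_le (H.integrable_bound.mul_const _)
    (Eventually.of_forall (H.fderiv_le_bound x hx))

end IsDominatedFamily

end

/-! ### Bilinear expressions in random variables -/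

section

variable {A B C : Type*} [NormedAddCommGroup A] [NormedSpace ℝ A] [NormedAddCommGroup B]
  [NormedSpace ℝ B] [NormedAddCommGroup C] [NormedSpace ℝ C] (β : A →L[ℝ] B →L[ℝ] C)

lemma norm_fderiv_bilinear_le {E : Type*} [NormedAddCommGroup E] [NormedSpace ℝ E]
    {u : E → A} {w : E → B} {x : E} (hu : DifferentiableAt ℝ u x) (hw : DifferentiableAt ℝ w x) :
    ‖fderiv ℝ (fun y => β (u y) (w y)) x‖
      ≤ ‖β‖ * (‖u x‖ * ‖fderiv ℝ w x‖ + ‖fderiv ℝ u x‖ * ‖w x‖) := by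
  rw [(β.hasFDerivAt_of_bilinear hu.hasFDerivAt hw.hasFDerivAt).fderiv]
  refine ContinuousLinearMap.opNorm_le_bound _ (by positivity) fun d => ?_
  have h1 := β.le_opNorm₂ (u x) (fderiv ℝ w x d)
  have h2 := β.le_opNorm₂ (fderiv ℝ u x d) (w x)
  have h3 := (fderiv ℝ w x).le_opNorm d
  have h4 := (fderiv ℝ u x).le_opNorm d
  calc ‖β (u x) (fderiv ℝ w x d) + β (fderiv ℝ u x d) (w x)‖
      ≤ ‖β‖ * ‖u x‖ * ‖fderiv ℝ w x d‖ + ‖β‖ * ‖fderiv ℝ u x d‖ * ‖w x‖ :=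
        (norm_add_le _ _).trans (add_le_add h1 h2)
    _ ≤ ‖β‖ * ‖u x‖ * (‖fderiv ℝ w x‖ * ‖d‖) + ‖β‖ * (‖fderiv ℝ u x‖ * ‖d‖) * ‖w x‖ := by
        gcongr
    _ = _ := by ring

variable {X : Type*} [MeasurableSpace X] {P : Measure X} [IsProbabilityMeasure P]
  {a : X → A} {b : X → B}

/-- After expansion every term but β(a, b) has a constant factor, so integrability of a and b
settles the rest. -/
lemma integrable_bilinear_fluctuation (ha : Integrable a P) (hb : Integrable b P)
    (hab : Integrable (fun ω => β (a ω) (b ω)) P) (a₀ : A) (b₀ : B) :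
    Integrable (fun ω => β (a ω - a₀) (b ω - b₀)) P := by
  have h1 : Integrable (fun ω => β (a ω) b₀) P := (β.flip b₀).integrable_comp ha
  have h2 : Integrable (fun ω => β a₀ (b ω)) P := (β a₀).integrable_comp hb
  refine ((hab.sub h1).sub (h2.sub (integrable_const (β a₀ b₀)))).congr
    (Eventually.of_forall fun ω => ?_)
  simp only [Pi.sub_apply, map_sub, sub_apply]
  abel

/-- The covariance of two random variables with respect to a bilinear form. -/
lemma integral_bilinear_fluctuation [CompleteSpace A] [CompleteSpace B] [CompleteSpace C]
    (ha : Integrable a P) (hb : Integrable b P)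
    (hab : Integrable (fun ω => β (a ω) (b ω)) P) :
    ∫ ω, β (a ω - ∫ ω, a ω ∂P) (b ω - ∫ ω, b ω ∂P) ∂P
      = (∫ ω, β (a ω) (b ω) ∂P) - β (∫ ω, a ω ∂P) (∫ ω, b ω ∂P) := by
  set a₀ := ∫ ω, a ω ∂P with ha₀
  set b₀ := ∫ ω, b ω ∂P with hb₀
  have h1 : Integrable (fun ω => β (a ω) b₀) P := (β.flip b₀).integrable_comp ha
  have h2 : Integrable (fun ω => β a₀ (b ω)) P := (β a₀).integrable_comp hb
  have e1 : ∫ ω, β (a ω) b₀ ∂P = β a₀ b₀ := (β.flip b₀).integral_comp_comm ha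
  have e2 : ∫ ω, β a₀ (b ω) ∂P = β a₀ b₀ := (β a₀).integral_comp_comm hb
  have e3 : (fun ω => β (a ω - a₀) (b ω - b₀))
      = fun ω => (β (a ω) (b ω) - β (a ω) b₀) - (β a₀ (b ω) - β a₀ b₀) := by
    ext ω
    simp only [map_sub, sub_apply]
    abel
  have i1 : Integrable (fun ω => β (a ω) (b ω) - β (a ω) b₀) P := hab.sub h1
  have i2 : Integrable (fun ω => β a₀ (b ω) - β a₀ b₀) P := h2.sub (integrable_const _)
  rw [e3, integral_sub i1 i2, integral_sub hab h1,
    integral_sub h2 (integrable_const _), e1, e2]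
  simp

end

/-- The inner product as a bilinear map. -/
noncomputable def innerCLM : E3 →L[ℝ] E3 →L[ℝ] ℝ := innerSL ℝ

lemma innerCLM_self (a : E3) : innerCLM a a = ‖a‖ ^ 2 := real_inner_self_eq_norm_sq a

/-- The cross product as a bilinear map. -/
noncomputable def crossCLM : E3 →L[ℝ] E3 →L[ℝ] E3 :=
  LinearMap.toContinuousBilinearMap (LinearMap.mk₂ ℝ cross
    (fun a a' b => by simp [cross]) (fun c a b => by simp [cross])
    (fun a b b' => by simp [cross]) (fun c a b => by simp [cross]))

lemma cross_eq (a b : E3) : cross a b = crossCLM a b := rfl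

/-- The gradient of a function as a linear function of its derivative. -/
noncomputable def gradCLM : (E3 →L[ℝ] ℝ) →L[ℝ] E3 :=
  LinearMap.toContinuousLinearMap
    { toFun := fun L => WithLp.toLp 2 fun i => L (EuclideanSpace.single i 1)
      map_add' := fun L L' => by ext i; simp
      map_smul' := fun c L => by ext i; simp }

lemma gradient_eq (φ : E3 → ℝ) (x : E3) : gradient φ x = gradCLM (fderiv ℝ φ x) := by
  ext i
  exact gradient_apply φ x i

lemma laplacian_eq (u : E3 → E3) (x : E3) :
    Laplacian.laplacian u x = ∑ i, fderiv ℝ (fderiv ℝ u) x (EuclideanSpace.single i 1)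
      (EuclideanSpace.single i 1) := by
  rw [InnerProductSpace.laplacian_eq_iteratedFDeriv_orthonormalBasis u
    (EuclideanSpace.basisFun (Fin 3) ℝ)]
  simp [iteratedFDeriv_two_apply]

/-! ### Random fields at a fixed time -/

section

variable {X : Type*} [MeasurableSpace X]

/-- Regularity and second moment bounds of a random velocity field `u` and a random pressure `p` at
a fixed time. -/
structure IsRandomField (P : Measure X) (Ω : Set E3) (u : E3 → X → E3) (p : E3 → X → ℝ)
    (M : X → ℝ) (g : E3 → ℝ) : Prop where
  isOpen : IsOpen Ω
  bounded : Bornology.IsBounded Ω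
  memLp : MemLp M 2 P
  nonneg : ∀ ω, 0 ≤ M ω
  g_nonneg : ∀ x, 0 ≤ g x
  g_continuousOn : ContinuousOn g Ω
  g_integrable : IntegrableOn g Ω
  meas : ∀ x ∈ Ω, AEStronglyMeasurable (u x) P
  meas_pressure : ∀ x ∈ Ω, AEStronglyMeasurable (p x) P
  contDiffOn : ∀ ω, ContDiffOn ℝ 2 (fun y => u y ω) Ω
  continuousOn : ∀ ω, ContinuousOn (fun y => u y ω) (closure Ω)
  contDiffOn_pressure : ∀ ω, ContDiffOn ℝ 1 (fun y => p y ω) Ω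
  eq_zero : ∀ ω, ∀ x ∈ frontier Ω, u x ω = 0
  le : ∀ x ∈ Ω, ∀ ω, ‖u x ω‖ ≤ M ω
  fderiv_le : ∀ x ∈ Ω, ∀ ω, ‖fderiv ℝ (fun y => u y ω) x‖ ≤ M ω
  fderiv_fderiv_le : ∀ x ∈ Ω, ∀ ω, ‖fderiv ℝ (fderiv ℝ (fun y => u y ω)) x‖ ≤ M ω * g x
  pressure_le : ∀ x ∈ Ω, ∀ ω, |p x ω| ≤ M ω ^ 2 * g x
  fderiv_pressure_le : ∀ x ∈ Ω, ∀ ω, ‖fderiv ℝ (fun y => p y ω) x‖ ≤ M ω ^ 2 * g x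

namespace IsRandomField

variable {P : Measure X} [IsProbabilityMeasure P] {Ω : Set E3} {u : E3 → X → E3}
  {p : E3 → X → ℝ} {M : X → ℝ} {g : E3 → ℝ}

lemma integrable_M (H : IsRandomField P Ω u p M g) : Integrable M P :=
  H.memLp.integrable one_le_two

lemma velocity (H : IsRandomField P Ω u p M g) : IsDominatedFamily P Ω u M (fun _ => 1) where
  isOpen := H.isOpen
  meas := H.meas
  contDiffOn ω := (H.contDiffOn ω).of_le one_le_two
  nonneg := H.nonneg
  integrable_bound := H.integrable_M
  continuousOn_bound := continuousOn_const
  le_bound x hx ω := by simpa using H.le x hx ω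
  fderiv_le_bound x hx ω := by simpa using H.fderiv_le x hx ω

omit [IsProbabilityMeasure P] in
lemma contDiffOn_fderiv (H : IsRandomField P Ω u p M g) (ω : X) :
    ContDiffOn ℝ 1 (fderiv ℝ fun y => u y ω) Ω :=
  (H.contDiffOn ω).fderiv_of_isOpen H.isOpen (by norm_num)

/-- The gradient is bounded by M alone and its derivative by M g, so the common weight is 1 + g.
This second family lets the mean be differentiated twice. -/
lemma gradient_family (H : IsRandomField P Ω u p M g) :
    IsDominatedFamily P Ω (fun x ω => fderiv ℝ (fun y => u y ω) x) M (fun x => 1 + g x) where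
  isOpen := H.isOpen
  meas _ hx := H.velocity.meas_fderiv hx
  contDiffOn := H.contDiffOn_fderiv
  nonneg := H.nonneg
  integrable_bound := H.integrable_M
  continuousOn_bound := continuousOn_const.add H.g_continuousOn
  le_bound x hx ω := (H.fderiv_le x hx ω).trans <| by
    nlinarith [mul_nonneg (H.nonneg ω) (H.g_nonneg x)]
  fderiv_le_bound x hx ω := (H.fderiv_fderiv_le x hx ω).trans <| by
    nlinarith [H.nonneg ω]

/-- A bilinear expression in a linear function of the velocity gradient and the velocity. -/
lemma convection_family (H : IsRandomField P Ω u p M g) :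
    IsDominatedFamily P Ω (fun x ω => cross (curl (fun y => u y ω) x) (u x ω))
      (fun ω => M ω ^ 2) (fun x => ‖crossCLM‖ * ‖curlCLM‖ * (1 + g x)) where
  isOpen := H.isOpen
  meas x hx := crossCLM.aestronglyMeasurable_comp₂
    (curlCLM.continuous.comp_aestronglyMeasurable (H.velocity.meas_fderiv hx)) (H.meas x hx)
  contDiffOn ω := by
    have h1 : ContDiffOn ℝ 1 (fun x => curlCLM (fderiv ℝ (fun y => u y ω) x)) Ω :=
      curlCLM.contDiff.comp_contDiffOn (H.contDiffOn_fderiv ω)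
    exact crossCLM.isBoundedBilinearMap.contDiff.comp_contDiffOn
      (h1.prodMk (H.velocity.contDiffOn ω))
  nonneg ω := sq_nonneg _
  integrable_bound := H.memLp.integrable_sq
  continuousOn_bound := continuousOn_const.mul (continuousOn_const.add H.g_continuousOn)
  le_bound x hx ω := by
    have h0 := H.nonneg ω
    have hg := H.g_nonneg x
    calc ‖crossCLM (curlCLM (fderiv ℝ (fun y => u y ω) x)) (u x ω)‖
        ≤ ‖crossCLM‖ * ‖curlCLM (fderiv ℝ (fun y => u y ω) x)‖ * ‖u x ω‖ :=
          crossCLM.le_opNorm₂ _ _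
      _ ≤ ‖crossCLM‖ * (‖curlCLM‖ * M ω) * M ω := by
          gcongr
          · exact (curlCLM.le_opNorm _).trans (by gcongr; exact H.fderiv_le x hx ω)
          · exact H.le x hx ω
      _ = M ω ^ 2 * (‖crossCLM‖ * ‖curlCLM‖ * (1 + 0)) := by ring
      _ ≤ _ := by gcongr
  fderiv_le_bound x hx ω := by
    have h0 := H.nonneg ω
    have hg := H.g_nonneg x
    have hd : DifferentiableAt ℝ (fderiv ℝ fun y => u y ω) x :=
      H.gradient_family.differentiableAt hx ω
    have hc : HasFDerivAt (fun x => curlCLM (fderiv ℝ (fun y => u y ω) x))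
        (curlCLM.comp (fderiv ℝ (fderiv ℝ fun y => u y ω) x)) x :=
      curlCLM.hasFDerivAt.comp x hd.hasFDerivAt
    have hb := norm_fderiv_bilinear_le crossCLM hc.differentiableAt
      (H.velocity.differentiableAt hx ω)
    rw [hc.fderiv] at hb
    refine hb.trans ?_
    have n1 : ‖curlCLM (fderiv ℝ (fun y => u y ω) x)‖ ≤ ‖curlCLM‖ * M ω :=
      (curlCLM.le_opNorm _).trans (by gcongr; exact H.fderiv_le x hx ω)
    have n2 : ‖curlCLM.comp (fderiv ℝ (fderiv ℝ fun y => u y ω) x)‖ ≤ ‖curlCLM‖ * (M ω * g x) :=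
      (ContinuousLinearMap.opNorm_comp_le _ _).trans
        (by gcongr; exact H.fderiv_fderiv_le x hx ω)
    -- The product rule yields vorticity times velocity gradient, of order M · M, and second
    -- derivatives times velocity, of order M g · M; together M²(1 + g).
    calc ‖crossCLM‖ * (‖curlCLM (fderiv ℝ (fun y => u y ω) x)‖ * ‖fderiv ℝ (fun y => u y ω) x‖
          + ‖curlCLM.comp (fderiv ℝ (fderiv ℝ fun y => u y ω) x)‖ * ‖u x ω‖)
        ≤ ‖crossCLM‖ * ((‖curlCLM‖ * M ω) * M ω + (‖curlCLM‖ * (M ω * g x)) * M ω) := by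
          gcongr
          · exact H.fderiv_le x hx ω
          · exact H.le x hx ω
      _ = _ := by ring

/-- The pressure contributes M²g, while |u|²/2 and its derivative ⟨u, ∇u⟩ are at most M². The sum is
averaged as a whole because its gradient is what enters the momentum equation. -/
lemma head_family (H : IsRandomField P Ω u p M g) :
    IsDominatedFamily P Ω (fun x ω => p x ω + ‖u x ω‖ ^ 2 / 2)
      (fun ω => M ω ^ 2) (fun x => 1 + g x) where
  isOpen := H.isOpen
  meas x hx := (H.meas_pressure x hx).add
    (((H.meas x hx).norm.pow 2).mul_const (2⁻¹ : ℝ) |>.congr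
      (Eventually.of_forall fun ω => by simp [div_eq_mul_inv]))
  contDiffOn ω := (H.contDiffOn_pressure ω).add
    (((H.velocity.contDiffOn ω).norm_sq ℝ).div_const 2)
  nonneg ω := sq_nonneg _
  integrable_bound := H.memLp.integrable_sq
  continuousOn_bound := continuousOn_const.add H.g_continuousOn
  le_bound x hx ω := by
    have h1 := H.pressure_le x hx ω
    have h2 : ‖u x ω‖ ^ 2 ≤ M ω ^ 2 := by gcongr; exact H.le x hx ω
    have h3 := abs_add_le (p x ω) (‖u x ω‖ ^ 2 / 2)
    rw [abs_of_nonneg (by positivity : 0 ≤ ‖u x ω‖ ^ 2 / 2)] at h3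
    rw [Real.norm_eq_abs]
    nlinarith [sq_nonneg ‖u x ω‖]
  fderiv_le_bound x hx ω := by
    have h0 := H.nonneg ω
    have hp : DifferentiableAt ℝ (fun y => p y ω) x :=
      ((H.contDiffOn_pressure ω).differentiableOn one_ne_zero x hx).differentiableAt
        (H.isOpen.mem_nhds hx)
    have h1 := (hp.hasFDerivAt.add
      (((H.velocity.differentiableAt hx ω).hasFDerivAt.norm_sq).mul_const (2⁻¹ : ℝ))).fderiv
    have h2 : (fun y => p y ω + ‖u y ω‖ ^ 2 / 2)
        = (fun y => p y ω) + fun y => ‖u y ω‖ ^ 2 * 2⁻¹ := by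
      ext y; simp [div_eq_mul_inv]
    rw [h2, h1]
    refine (norm_add_le _ _).trans ?_
    have h3 : ‖(2⁻¹ : ℝ) • 2 • (innerSL ℝ (u x ω)).comp (fderiv ℝ (fun y => u y ω) x)‖
        ≤ M ω ^ 2 := by
      have h4 : (2⁻¹ : ℝ) • 2 • (innerSL ℝ (u x ω)).comp (fderiv ℝ (fun y => u y ω) x)
          = (innerSL ℝ (u x ω)).comp (fderiv ℝ (fun y => u y ω) x) := by
        ext d; simp
      rw [h4, pow_two]
      refine (ContinuousLinearMap.opNorm_comp_le _ _).trans ?_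
      rw [innerSL_apply_norm]
      gcongr
      · exact H.le x hx ω
      · exact H.fderiv_le x hx ω
    nlinarith [H.fderiv_pressure_le x hx ω]

/-! #### The mean velocity -/

lemma fderiv_mean_eqOn (H : IsRandomField P Ω u p M g) :
    EqOn (fderiv ℝ fun x => ∫ ω, u x ω ∂P) (fun x => ∫ ω, fderiv ℝ (fun y => u y ω) x ∂P) Ω :=
  fun _ hx => H.velocity.fderiv_integral hx

lemma contDiffOn_mean (H : IsRandomField P Ω u p M g) :
    ContDiffOn ℝ 2 (fun x => ∫ ω, u x ω ∂P) Ω := by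
  have := (contDiffOn_succ_iff_fderiv_of_isOpen (𝕜 := ℝ) (n := 1)
    (f := fun x => ∫ ω, u x ω ∂P) H.isOpen).2
    ⟨H.velocity.contDiffOn_integral.differentiableOn one_ne_zero, by simp,
      H.gradient_family.contDiffOn_integral.congr H.fderiv_mean_eqOn⟩
  rwa [one_add_one_eq_two] at this

lemma fderiv_fderiv_mean (H : IsRandomField P Ω u p M g) {x : E3} (hx : x ∈ Ω) :
    fderiv ℝ (fderiv ℝ fun x => ∫ ω, u x ω ∂P) x
      = ∫ ω, fderiv ℝ (fderiv ℝ fun y => u y ω) x ∂P := by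
  rw [← H.gradient_family.fderiv_integral hx]
  exact (H.fderiv_mean_eqOn.eventuallyEq_of_mem (H.isOpen.mem_nhds hx)).fderiv_eq

omit [IsProbabilityMeasure P] in
lemma meas_closure (H : IsRandomField P Ω u p M g) {x : E3} (hx : x ∈ closure Ω) :
    AEStronglyMeasurable (u x) P := by
  by_cases hxΩ : x ∈ Ω
  · exact H.meas x hxΩ
  · have : u x = fun _ => 0 := funext fun ω => H.eq_zero ω x ⟨hx, by rwa [H.isOpen.interior_eq]⟩
    rw [this]
    exact aestronglyMeasurable_const

omit [IsProbabilityMeasure P] in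
lemma le_closure (H : IsRandomField P Ω u p M g) {x : E3} (hx : x ∈ closure Ω) (ω : X) :
    ‖u x ω‖ ≤ M ω := by
  by_cases hxΩ : x ∈ Ω
  · exact H.le x hxΩ ω
  · rw [H.eq_zero ω x ⟨hx, by rwa [H.isOpen.interior_eq]⟩, norm_zero]
    exact H.nonneg ω

lemma continuousOn_mean (H : IsRandomField P Ω u p M g) :
    ContinuousOn (fun x => ∫ ω, u x ω ∂P) (closure Ω) := fun x hx =>
  continuousWithinAt_of_dominated (bound := M)
    (eventually_mem_nhdsWithin.mono fun _ hy => H.meas_closure hy)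
    (eventually_mem_nhdsWithin.mono fun _ hy => Eventually.of_forall (H.le_closure hy))
    H.integrable_M (Eventually.of_forall fun ω => H.continuousOn ω x hx)

omit [IsProbabilityMeasure P] in
lemma mean_eq_zero (H : IsRandomField P Ω u p M g) {x : E3} (hx : x ∈ frontier Ω) :
    ∫ ω, u x ω ∂P = 0 := by
  simp_rw [fun ω => H.eq_zero ω x hx]
  simp

lemma integrable_curl (H : IsRandomField P Ω u p M g) {x : E3} (hx : x ∈ Ω) :
    Integrable (fun ω => curl (fun y => u y ω) x) P :=
  curlCLM.integrable_comp (H.velocity.integrable_fderiv hx)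

lemma integral_curl (H : IsRandomField P Ω u p M g) {x : E3} (hx : x ∈ Ω) :
    ∫ ω, curl (fun y => u y ω) x ∂P = curl (fun y => ∫ ω, u y ω ∂P) x := by
  rw [curl_eq, H.velocity.fderiv_integral hx]
  exact curlCLM.integral_comp_comm (H.velocity.integrable_fderiv hx)

lemma integral_div (H : IsRandomField P Ω u p M g) {x : E3} (hx : x ∈ Ω) :
    ∫ ω, div (fun y => u y ω) x ∂P = div (fun y => ∫ ω, u y ω ∂P) x := by
  rw [div_eq, H.velocity.fderiv_integral hx]
  exact divCLM.integral_comp_comm (H.velocity.integrable_fderiv hx)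

lemma integrable_laplacian (H : IsRandomField P Ω u p M g) {x : E3} (hx : x ∈ Ω) :
    Integrable (fun ω => Laplacian.laplacian (fun y => u y ω) x) P := by
  simp_rw [laplacian_eq]
  exact integrable_finsetSum _ fun i _ =>
    ((H.gradient_family.integrable_fderiv hx).apply_continuousLinearMap _).apply_continuousLinearMap
      _

lemma integral_laplacian (H : IsRandomField P Ω u p M g) {x : E3} (hx : x ∈ Ω) :
    ∫ ω, Laplacian.laplacian (fun y => u y ω) x ∂P
      = Laplacian.laplacian (fun y => ∫ ω, u y ω ∂P) x := by
  have hi := H.gradient_family.integrable_fderiv hx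
  simp_rw [laplacian_eq]
  rw [H.fderiv_fderiv_mean hx, integral_finsetSum _ fun i _ =>
    (hi.apply_continuousLinearMap _).apply_continuousLinearMap _]
  refine Finset.sum_congr rfl fun i _ => ?_
  rw [ContinuousLinearMap.integral_apply hi,
    ContinuousLinearMap.integral_apply (hi.apply_continuousLinearMap _)]

lemma integrable_gradient_head (H : IsRandomField P Ω u p M g) {x : E3} (hx : x ∈ Ω) :
    Integrable (fun ω => gradient (fun y => p y ω + ‖u y ω‖ ^ 2 / 2) x) P := by
  simp_rw [gradient_eq]
  exact gradCLM.integrable_comp (H.head_family.integrable_fderiv hx)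

lemma integral_gradient_head (H : IsRandomField P Ω u p M g) {x : E3} (hx : x ∈ Ω) :
    ∫ ω, gradient (fun y => p y ω + ‖u y ω‖ ^ 2 / 2) x ∂P
      = gradient (fun y => ∫ ω, (p y ω + ‖u y ω‖ ^ 2 / 2) ∂P) x := by
  simp_rw [gradient_eq]
  rw [H.head_family.fderiv_integral hx]
  exact gradCLM.integral_comp_comm (H.head_family.integrable_fderiv hx)

omit [IsProbabilityMeasure P] in
lemma integrable_pressure (H : IsRandomField P Ω u p M g) {x : E3} (hx : x ∈ Ω) :
    Integrable (p x) P :=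
  (H.memLp.integrable_sq.mul_const (g x)).mono' (H.meas_pressure x hx)
    (Eventually.of_forall (H.pressure_le x hx))

omit [IsProbabilityMeasure P] in
lemma integrable_norm_sq (H : IsRandomField P Ω u p M g) {x : E3} (hx : x ∈ Ω) :
    Integrable (fun ω => ‖u x ω‖ ^ 2) P :=
  H.memLp.integrable_sq.mono' ((H.meas x hx).norm.pow 2) (Eventually.of_forall fun ω => by
    rw [Real.norm_of_nonneg (by positivity)]
    gcongr
    exact H.le x hx ω)

lemma integrable_norm_sq_fluctuation (H : IsRandomField P Ω u p M g) {x : E3} (hx : x ∈ Ω) :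
    Integrable (fun ω => ‖u x ω - ∫ ω, u x ω ∂P‖ ^ 2) P := by
  have hi := H.velocity.integrable hx
  have h := integrable_bilinear_fluctuation innerCLM hi hi
    (by simpa only [innerCLM_self] using H.integrable_norm_sq hx) (∫ ω, u x ω ∂P) (∫ ω, u x ω ∂P)
  simpa only [innerCLM_self] using h

/-- The variance identity: the mean of |u|² exceeds the square of the mean by the mean square
fluctuation. Half of that excess is the turbulent kinetic energy in the averaged pressure. -/
lemma integral_head (H : IsRandomField P Ω u p M g) {x : E3} (hx : x ∈ Ω) :
    ∫ ω, (p x ω + ‖u x ω‖ ^ 2 / 2) ∂P = (∫ ω, p x ω ∂P) + ‖∫ ω, u x ω ∂P‖ ^ 2 / 2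
      + 1 / 2 * ∫ ω, ‖u x ω - ∫ ω, u x ω ∂P‖ ^ 2 ∂P := by
  have hi := H.velocity.integrable hx
  have h := integral_bilinear_fluctuation innerCLM hi hi
    (by simpa only [innerCLM_self] using H.integrable_norm_sq hx)
  simp only [innerCLM_self] at h
  rw [h, integral_add (H.integrable_pressure hx) ((H.integrable_norm_sq hx).div_const 2),
    MeasureTheory.integral_div]
  ring

end IsRandomField

end

/-! ### The turbulent stress at a fixed time. -/

section

variable {X : Type*} [MeasurableSpace X]

/-- The mean of the cross product of the fluctuations of vorticity and velocity at a fixed time. -/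
noncomputable def stress (P : Measure X) (u : E3 → X → E3) (x : E3) : E3 :=
  ∫ ω, cross (curl (fun y => u y ω) x - ∫ ω, curl (fun y => u y ω) x ∂P)
    (u x ω - ∫ ω, u x ω ∂P) ∂P

namespace IsRandomField

variable {P : Measure X} [IsProbabilityMeasure P] {Ω : Set E3} {u : E3 → X → E3}
  {p : E3 → X → ℝ} {M : X → ℝ} {g : E3 → ℝ}

lemma integrable_cross_fluctuation (H : IsRandomField P Ω u p M g) {x : E3} (hx : x ∈ Ω) :
    Integrable (fun ω => cross (curl (fun y => u y ω) x - ∫ ω, curl (fun y => u y ω) x ∂P)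
      (u x ω - ∫ ω, u x ω ∂P)) P :=
  integrable_bilinear_fluctuation crossCLM (H.integrable_curl hx) (H.velocity.integrable hx)
    (H.convection_family.integrable hx) _ _

/-- The covariance formula for the cross product. It exhibits the stress in Ω as a difference of two
C¹ fields, and supplies the stress term when the convection term is averaged. -/
lemma stress_eq (H : IsRandomField P Ω u p M g) {x : E3} (hx : x ∈ Ω) :
    stress P u x = (∫ ω, cross (curl (fun y => u y ω) x) (u x ω) ∂P)
      - cross (curl (fun y => ∫ ω, u y ω ∂P) x) (∫ ω, u x ω ∂P) := by
  rw [← H.integral_curl hx]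
  exact integral_bilinear_fluctuation crossCLM (H.integrable_curl hx)
    (H.velocity.integrable hx) (H.convection_family.integrable hx)

omit [IsProbabilityMeasure P] in
-- The velocity fluctuation is zero for every ω, so the integrand vanishes whatever value the formal
-- curl takes at a boundary point.
lemma stress_eq_zero (H : IsRandomField P Ω u p M g) {x : E3} (hx : x ∈ frontier Ω) :
    stress P u x = 0 := by
  have h : ∀ ω, u x ω - ∫ ω, u x ω ∂P = 0 := fun ω => by
    rw [H.eq_zero ω x hx, H.mean_eq_zero hx, sub_zero]
  simp only [stress, cross_eq, h, map_zero, integral_zero]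

lemma contDiffOn_fderiv_mean (H : IsRandomField P Ω u p M g) :
    ContDiffOn ℝ 1 (fderiv ℝ fun x => ∫ ω, u x ω ∂P) Ω :=
  H.contDiffOn_mean.fderiv_of_isOpen H.isOpen (by norm_num)

lemma contDiffOn_mean_convection (H : IsRandomField P Ω u p M g) :
    ContDiffOn ℝ 1
      (fun x => cross (curl (fun y => ∫ ω, u y ω ∂P) x) (∫ ω, u x ω ∂P)) Ω := by
  have h1 : ContDiffOn ℝ 1 (fun x => curlCLM (fderiv ℝ (fun y => ∫ ω, u y ω ∂P) x)) Ω :=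
    curlCLM.contDiff.comp_contDiffOn H.contDiffOn_fderiv_mean
  exact crossCLM.isBoundedBilinearMap.contDiff.comp_contDiffOn
    (h1.prodMk H.velocity.contDiffOn_integral)

lemma contDiffOn_stress (H : IsRandomField P Ω u p M g) : ContDiffOn ℝ 1 (stress P u) Ω :=
  (H.convection_family.contDiffOn_integral.sub H.contDiffOn_mean_convection).congr
    fun _ hx => H.stress_eq hx

lemma norm_mean_le (H : IsRandomField P Ω u p M g) {x : E3} (hx : x ∈ closure Ω) :
    ‖∫ ω, u x ω ∂P‖ ≤ ∫ ω, M ω ∂P :=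
  norm_integral_le_of_norm_le H.integrable_M (Eventually.of_forall (H.le_closure hx))

/-- Only boundary points need an argument. The vorticity need not converge there, but it is bounded
by a multiple of M, so |s| is at most the mean of c(M + m) times the velocity fluctuation. This
tends to 0 by dominated convergence, (M + m)² being integrable because M is in L². -/
lemma continuousOn_stress (H : IsRandomField P Ω u p M g) :
    ContinuousOn (stress P u) (closure Ω) := by
  intro x hx
  by_cases hxΩ : x ∈ Ω
  · exact (H.contDiffOn_stress.continuousOn.continuousAt
      (H.isOpen.mem_nhds hxΩ)).continuousWithinAt
  have hxf : x ∈ frontier Ω := ⟨hx, by rwa [H.isOpen.interior_eq]⟩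
  set m := ∫ ω, M ω ∂P with hm
  have hm0 : 0 ≤ m := integral_nonneg H.nonneg
  set c := ‖crossCLM‖ * ‖curlCLM‖ with hc
  have hi2 : Integrable (fun ω => c * (M ω + m) * (M ω + m)) P := by
    have : Integrable (fun ω => c * (M ω ^ 2 + 2 * m * M ω + m ^ 2)) P :=
      ((H.memLp.integrable_sq.add (H.integrable_M.const_mul _)).add
        (integrable_const _)).const_mul c
    exact this.congr (Eventually.of_forall fun ω => by ring)
  have hfl : ∀ y ∈ closure Ω, ∀ ω, ‖u y ω - ∫ ω, u y ω ∂P‖ ≤ M ω + m := fun y hy ω =>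
    (norm_sub_le _ _).trans (add_le_add (H.le_closure hy ω) (H.norm_mean_le hy))
  have hbd : ∀ y ∈ closure Ω, ∀ ω, c * (M ω + m) * ‖u y ω - ∫ ω, u y ω ∂P‖
      ≤ c * (M ω + m) * (M ω + m) := fun y hy ω => by
    have := H.nonneg ω
    have := hfl y hy ω
    gcongr
  have hmeas : ∀ y ∈ closure Ω, AEStronglyMeasurable
      (fun ω => c * (M ω + m) * ‖u y ω - ∫ ω, u y ω ∂P‖) P := fun y hy =>
    ((H.integrable_M.aestronglyMeasurable.add aestronglyMeasurable_const).const_mul c).mul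
      ((H.meas_closure hy).sub aestronglyMeasurable_const).norm
  have hle : ∀ y ∈ closure Ω, ∀ ω, ‖c * (M ω + m) * ‖u y ω - ∫ ω, u y ω ∂P‖‖
      ≤ c * (M ω + m) * (M ω + m) := fun y hy ω => by
    have := H.nonneg ω
    rw [Real.norm_of_nonneg (by positivity)]
    exact hbd y hy ω
  have hcont : ContinuousWithinAt (fun y => ∫ ω, c * (M ω + m) * ‖u y ω - ∫ ω, u y ω ∂P‖ ∂P)
      (closure Ω) x :=
    continuousWithinAt_of_dominated
      (eventually_mem_nhdsWithin.mono hmeas)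
      (eventually_mem_nhdsWithin.mono fun y hy => Eventually.of_forall (hle y hy)) hi2
      (Eventually.of_forall fun ω => continuousWithinAt_const.mul
        ((H.continuousOn ω x hx).sub (H.continuousOn_mean x hx)).norm)
  have hzero : ∫ ω, c * (M ω + m) * ‖u x ω - ∫ ω, u x ω ∂P‖ ∂P = 0 := by
    have h : ∀ ω, u x ω - ∫ ω, u x ω ∂P = 0 := fun ω => by
      rw [H.eq_zero ω x hxf, H.mean_eq_zero hxf, sub_zero]
    simp only [h, norm_zero, mul_zero, integral_zero]
  rw [ContinuousWithinAt, hzero] at hcont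
  rw [ContinuousWithinAt, H.stress_eq_zero hxf]
  refine squeeze_zero_norm' (eventually_mem_nhdsWithin.mono fun y hy => ?_) hcont
  refine norm_integral_le_of_norm_le (hi2.mono' (hmeas y hy) (Eventually.of_forall (hle y hy)))
    (Eventually.of_forall fun ω => ?_)
  have h0 := H.nonneg ω
  by_cases hyΩ : y ∈ Ω
  · have hcurl : ∀ ω, ‖curl (fun y => u y ω) y‖ ≤ ‖curlCLM‖ * M ω := fun ω =>
      (curlCLM.le_opNorm _).trans (by gcongr; exact H.fderiv_le y hyΩ ω)
    have hmc : ‖∫ ω, curl (fun y => u y ω) y ∂P‖ ≤ ‖curlCLM‖ * m := by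
      rw [hm, ← integral_const_mul]
      exact norm_integral_le_of_norm_le (H.integrable_M.const_mul _) (Eventually.of_forall hcurl)
    calc _ ≤ ‖crossCLM‖ * ‖curl (fun y => u y ω) y - ∫ ω, curl (fun y => u y ω) y ∂P‖
          * ‖u y ω - ∫ ω, u y ω ∂P‖ := crossCLM.le_opNorm₂ _ _
      _ ≤ ‖crossCLM‖ * (‖curlCLM‖ * M ω + ‖curlCLM‖ * m) * ‖u y ω - ∫ ω, u y ω ∂P‖ := by
          gcongr
          exact (norm_sub_le _ _).trans (add_le_add (hcurl ω) hmc)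
      _ = _ := by rw [hc]; ring
  · have hyf : y ∈ frontier Ω := ⟨hy, by rwa [H.isOpen.interior_eq]⟩
    rw [H.eq_zero ω y hyf, H.mean_eq_zero hyf, cross_eq]
    simp

/-- The derivative of s is dominated by a multiple of 1 + g, integrable because Ω is bounded. The
potentials converge and the Helmholtz decomposition applies for this reason. -/
lemma integrableOn_fderiv_stress (H : IsRandomField P Ω u p M g) :
    IntegrableOn (fderiv ℝ (stress P u)) Ω := by
  set m := ∫ ω, M ω ∂P with hm
  have hm0 : 0 ≤ m := integral_nonneg H.nonneg
  set m₂ := ∫ ω, M ω ^ 2 ∂P with hm₂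
  set c := ‖crossCLM‖ * ‖curlCLM‖ with hc
  -- The term m₂c bounds the derivative of the mean convection; 2cm² bounds the two product-rule
  -- terms of the convection of the means.
  have hdom : IntegrableOn (fun x => (m₂ * c + c * (2 * m ^ 2)) * (1 + g x)) Ω :=
    ((integrableOn_const H.bounded.measure_lt_top.ne).add H.g_integrable).const_mul _
  refine Integrable.mono' hdom ((H.contDiffOn_stress.continuousOn_fderiv_of_isOpen H.isOpen
    le_rfl).aestronglyMeasurable H.isOpen.measurableSet) ?_
  rw [ae_restrict_iff' H.isOpen.measurableSet]
  refine Eventually.of_forall fun x hx => ?_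
  have hg := H.g_nonneg x
  have hn := H.isOpen.mem_nhds hx
  have h1 := (H.convection_family.hasFDerivAt hx).differentiableAt
  have h2 := (H.contDiffOn_mean_convection.differentiableOn one_ne_zero x hx).differentiableAt hn
  have e1 : fderiv ℝ (stress P u) x
      = fderiv ℝ (fun x => ∫ ω, cross (curl (fun y => u y ω) x) (u x ω) ∂P) x
        - fderiv ℝ (fun x => cross (curl (fun y => ∫ ω, u y ω ∂P) x) (∫ ω, u x ω ∂P)) x := by
    rw [← fderiv_sub h1 h2]
    refine Filter.EventuallyEq.fderiv_eq ?_
    filter_upwards [hn] with y hy using H.stress_eq hy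
  have n1 := H.convection_family.norm_fderiv_integral_le hx
  have hd : DifferentiableAt ℝ (fderiv ℝ fun y => ∫ ω, u y ω ∂P) x :=
    (H.contDiffOn_fderiv_mean.differentiableOn one_ne_zero x hx).differentiableAt hn
  have hcu : HasFDerivAt (fun x => curlCLM (fderiv ℝ (fun y => ∫ ω, u y ω ∂P) x))
      (curlCLM.comp (fderiv ℝ (fderiv ℝ fun y => ∫ ω, u y ω ∂P) x)) x :=
    curlCLM.hasFDerivAt.comp x hd.hasFDerivAt
  have hu := (H.velocity.hasFDerivAt hx).differentiableAt
  have n2 := norm_fderiv_bilinear_le crossCLM hcu.differentiableAt hu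
  rw [hcu.fderiv] at n2
  have b1 : ‖∫ ω, u x ω ∂P‖ ≤ m := H.norm_mean_le (subset_closure hx)
  have b2 : ‖fderiv ℝ (fun y => ∫ ω, u y ω ∂P) x‖ ≤ m := by
    simpa using H.velocity.norm_fderiv_integral_le hx
  have b3 : ‖fderiv ℝ (fderiv ℝ fun y => ∫ ω, u y ω ∂P) x‖ ≤ m * (1 + g x) := by
    rw [H.fderiv_fderiv_mean hx, ← H.gradient_family.fderiv_integral hx]
    exact H.gradient_family.norm_fderiv_integral_le hx
  have b4 : ‖curlCLM (fderiv ℝ (fun y => ∫ ω, u y ω ∂P) x)‖ ≤ ‖curlCLM‖ * m :=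
    (curlCLM.le_opNorm _).trans (by gcongr)
  have b5 : ‖curlCLM.comp (fderiv ℝ (fderiv ℝ fun y => ∫ ω, u y ω ∂P) x)‖
      ≤ ‖curlCLM‖ * (m * (1 + g x)) :=
    (ContinuousLinearMap.opNorm_comp_le _ _).trans (by gcongr)
  rw [e1]
  calc _ ≤ m₂ * (c * (1 + g x)) + ‖crossCLM‖ * ((‖curlCLM‖ * m) * (m * (1 + g x))
          + (‖curlCLM‖ * (m * (1 + g x))) * m) := by
        refine (norm_sub_le _ _).trans (add_le_add n1 (n2.trans ?_))
        have : m ≤ m * (1 + g x) := by nlinarith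
        have b2' := b2.trans this
        gcongr
    _ = _ := by rw [hc]; ring

end IsRandomField

end

/-! ### Attainment of the mean initial value -/

section

variable {X : Type*} [MeasurableSpace X]

/-- A Carathéodory function, continuous in x and measurable in ω, is jointly measurable. The
extension by zero off Ω makes it a function on the whole product, ready for Tonelli. -/
lemma measurable_of_continuousOn_of_measurable {Ω : Set E3} (hΩ : IsOpen Ω) {w : E3 → X → E3}
    (hc : ∀ ω, ContinuousOn (fun x => w x ω) Ω) (hm : ∀ x ∈ Ω, Measurable (w x)) :
    Measurable fun z : E3 × X => Ω.indicator (fun x => w x z.2) z.1 := by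
  have hs : MeasurableSet (Prod.fst ⁻¹' Ω : Set (E3 × X)) := measurable_fst hΩ.measurableSet
  have h1 : Measurable (Function.uncurry fun (x : Ω) ω => w x ω) :=
    measurable_uncurry_of_continuous_of_measurable (fun ω => (hc ω).domRestrict) fun x => hm x x.2
  refine measurable_of_restrict_of_restrict_compl hs ?_ ?_
  · have h2 : Measurable fun z : (Prod.fst ⁻¹' Ω : Set (E3 × X)) => ((⟨z.1.1, z.2⟩ : Ω), z.1.2) :=
      ((measurable_fst.comp measurable_subtype_coe).subtype_mk).prodMk
        (measurable_snd.comp measurable_subtype_coe)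
    convert h1.comp h2 using 1
    ext1 z
    exact indicator_of_mem (s := Ω) z.2 fun x => w x z.1.2
  · convert measurable_const (a := (0 : E3)) using 1
    ext1 z
    exact indicator_of_notMem (s := Ω) z.2 fun x => w x z.1.2

lemma sq_eLpNorm_two {α E : Type*} [MeasurableSpace α] [NormedAddCommGroup E] (f : α → E)
    (μ : Measure α) : eLpNorm f 2 μ ^ 2 = ∫⁻ x, ‖f x‖ₑ ^ 2 ∂μ := by
  have := eLpNorm_nnreal_pow_eq_lintegral (f := f) (μ := μ) (p := 2) two_ne_zero
  simp_rw [NNReal.coe_ofNat, ENNReal.rpow_ofNat, ENNReal.coe_ofNat] at this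
  exact this

/-- Jensen's inequality for the square of the norm. -/
lemma enorm_integral_sub_sq_le {E : Type*} [NormedAddCommGroup E] [NormedSpace ℝ E]
    {P : Measure X} [IsProbabilityMeasure P] {a b : X → E} (ha : Integrable a P)
    (hb : AEStronglyMeasurable b P) :
    ‖(∫ ω, a ω ∂P) - ∫ ω, b ω ∂P‖ₑ ^ 2 ≤ ∫⁻ ω, ‖a ω - b ω‖ₑ ^ 2 ∂P := by
  have hw : AEStronglyMeasurable (fun ω => a ω - b ω) P := ha.aestronglyMeasurable.sub hb
  rw [← sq_eLpNorm_two (fun ω => a ω - b ω) P]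
  -- An infinite right-hand side leaves nothing to prove; a finite one makes a − b, and hence b,
  -- integrable. Thus measurability of b suffices.
  rcases eq_or_ne (eLpNorm (fun ω => a ω - b ω) 2 P) ∞ with h | h
  · simp [h]
  have hw2 : MemLp (fun ω => a ω - b ω) 2 P := ⟨hw, lt_top_iff_ne_top.2 h⟩
  have hb' : Integrable b P := (ha.sub (hw2.integrable one_le_two)).congr
    (Eventually.of_forall fun ω => by simp)
  rw [← integral_sub ha hb']
  gcongr
  calc ‖∫ ω, a ω - b ω ∂P‖ₑ ≤ ∫⁻ ω, ‖a ω - b ω‖ₑ ∂P := enorm_integral_le_lintegral_enorm _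
    _ = eLpNorm (fun ω => a ω - b ω) 1 P := eLpNorm_one_eq_lintegral_enorm.symm
    _ ≤ _ := eLpNorm_le_eLpNorm_of_exponent_le one_le_two hw

/-- Jensen in ω and Tonelli bound the squared L²(Ω) distance of the means by the mean of the squared
distances. The latter tends to 0 for every ω and is dominated because M is in L². -/
theorem tendsto_eLpNorm_mean_sub {P : Measure X} [IsProbabilityMeasure P] {Ω : Set E3}
    (hΩ : IsOpen Ω) {T : ℝ} (hT : 0 < T) {v : ℝ → E3 → X → E3} {v₀ : E3 → X → E3}
    (hv₀ : Measurable fun z : E3 × X => v₀ z.1 z.2)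
    (hm : ∀ t ∈ Ioo 0 T, ∀ x ∈ Ω, Measurable (v t x))
    (hi : ∀ t ∈ Ioo 0 T, ∀ x ∈ Ω, Integrable (v t x) P)
    (hc : ∀ t ∈ Ioo 0 T, ∀ ω, ContinuousOn (fun x => v t x ω) Ω)
    (hlim : ∀ ω, Tendsto (fun t => eLpNorm (fun x => v t x ω - v₀ x ω) 2 (volume.restrict Ω))
      (𝓝[>] 0) (𝓝 0))
    {δ : ℝ} (hδ : 0 < δ) {M : X → ℝ} (hM : MemLp M 2 P)
    (hb : ∀ t ∈ Ioo 0 δ, ∀ ω,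
      eLpNorm (fun x => v t x ω) 2 (volume.restrict Ω) ≤ ENNReal.ofReal (M ω)) :
    Tendsto (fun t => eLpNorm (fun x => (∫ ω, v t x ω ∂P) - ∫ ω, v₀ x ω ∂P) 2
      (volume.restrict Ω)) (𝓝[>] 0) (𝓝 0) := by
  have hm₀ : ∀ x, Measurable (v₀ x) := fun x => hv₀.comp (measurable_const.prodMk measurable_id)
  have hm₀' : ∀ ω, Measurable fun x => v₀ x ω :=
    fun ω => hv₀.comp (measurable_id.prodMk measurable_const)
  have hmx : ∀ t ∈ Ioo 0 T, ∀ ω,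
      AEStronglyMeasurable (fun x => v t x ω) (volume.restrict Ω) :=
    fun t ht ω => (hc t ht ω).aestronglyMeasurable hΩ.measurableSet
  have ev : ∀ᶠ t in 𝓝[>] (0 : ℝ), t ∈ Ioo 0 T ∧ t ∈ Ioo 0 δ :=
    inter_mem (Ioo_mem_nhdsGT hT) (Ioo_mem_nhdsGT hδ)
  -- the initial value is bounded like the solution
  have hb₀ : ∀ ω, eLpNorm (fun x => v₀ x ω) 2 (volume.restrict Ω) ≤ ENNReal.ofReal (M ω) := by
    intro ω
    have h1 := (hlim ω).const_add (ENNReal.ofReal (M ω))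
    rw [add_zero] at h1
    refine ge_of_tendsto h1 (ev.mono fun t ht => ?_)
    have h2 := eLpNorm_sub_le (hmx t ht.1 ω)
      ((hmx t ht.1 ω).sub (hm₀' ω).aestronglyMeasurable) (p := 2) one_le_two
    have h3 : (fun x => v t x ω) - ((fun x => v t x ω) - fun x => v₀ x ω) = fun x => v₀ x ω :=
      sub_sub_cancel _ _
    rw [h3] at h2
    exact h2.trans (add_le_add_left (hb t ht.2 ω) _)
  -- joint measurability of the difference
  have hW : ∀ t ∈ Ioo 0 T, Measurable fun z : E3 × X =>
      ‖Ω.indicator (fun x => v t x z.2) z.1 - v₀ z.1 z.2‖ₑ ^ 2 := fun t ht =>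
    (((measurable_of_continuousOn_of_measurable hΩ (hc t ht) (hm t ht)).sub hv₀).enorm).pow_const 2
  have hN : ∀ t ω, eLpNorm (fun x => v t x ω - v₀ x ω) 2 (volume.restrict Ω) ^ 2
      = ∫⁻ x in Ω, ‖Ω.indicator (fun x => v t x ω) x - v₀ x ω‖ₑ ^ 2 := fun t ω => by
    rw [sq_eLpNorm_two]
    exact setLIntegral_congr_fun hΩ.measurableSet fun x hx => by simp only [indicator_of_mem hx]
  have hNm : ∀ t ∈ Ioo 0 T, Measurable fun ω =>
      eLpNorm (fun x => v t x ω - v₀ x ω) 2 (volume.restrict Ω) ^ 2 := fun t ht => by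
    simp_rw [hN]
    exact (hW t ht).lintegral_prod_left'
  have hle : ∀ t ∈ Ioo 0 T,
      eLpNorm (fun x => (∫ ω, v t x ω ∂P) - ∫ ω, v₀ x ω ∂P) 2 (volume.restrict Ω) ^ 2
      ≤ ∫⁻ ω, eLpNorm (fun x => v t x ω - v₀ x ω) 2 (volume.restrict Ω) ^ 2 ∂P := by
    intro t ht
    simp_rw [hN]
    rw [sq_eLpNorm_two, lintegral_lintegral_swap
      (f := fun ω x => ‖Ω.indicator (fun x => v t x ω) x - v₀ x ω‖ₑ ^ 2)
      ((hW t ht).comp measurable_swap).aemeasurable]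
    refine setLIntegral_mono_ae' hΩ.measurableSet (Eventually.of_forall fun x hx => ?_)
    simp only [indicator_of_mem hx]
    exact enorm_integral_sub_sq_le (hi t ht x hx) (hm₀ x).aestronglyMeasurable
  have hlim2 : Tendsto (fun t => ∫⁻ ω,
      eLpNorm (fun x => v t x ω - v₀ x ω) 2 (volume.restrict Ω) ^ 2 ∂P) (𝓝[>] 0)
      (𝓝 (∫⁻ _, 0 ∂P)) := by
    -- The L²(Ω) norms of v and v₀ are each at most M, so the squared norm of their difference is at
    -- most (M + M)² = 4M².
    refine tendsto_lintegral_filter_of_dominated_convergence (fun ω => 4 * ‖M ω‖ₑ ^ 2)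
      (ev.mono fun t ht => hNm t ht.1)
      (ev.mono fun t ht => Eventually.of_forall fun ω => ?_) ?_
      (Eventually.of_forall fun ω => ?_)
    · have h1 := eLpNorm_sub_le (hmx t ht.1 ω) (hm₀' ω).aestronglyMeasurable (p := 2)
        (μ := volume.restrict Ω) one_le_two
      have h2 : ENNReal.ofReal (M ω) ≤ ‖M ω‖ₑ := Real.ofReal_le_enorm _
      calc _ ≤ (‖M ω‖ₑ + ‖M ω‖ₑ) ^ 2 := by
            gcongr
            exact h1.trans (add_le_add ((hb t ht.2 ω).trans h2) ((hb₀ ω).trans h2))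
        _ = _ := by ring
    · rw [lintegral_const_mul' _ _ (by simp), ← sq_eLpNorm_two]
      exact ENNReal.mul_ne_top (by simp) (ENNReal.pow_ne_top hM.2.ne)
    · have := ((ENNReal.continuous_pow 2).tendsto 0).comp (hlim ω)
      simpa [Function.comp_def] using this
  rw [lintegral_zero] at hlim2
  have hlim3 := (ENNReal.continuous_rpow_const (y := (1 / 2 : ℝ))).tendsto 0 |>.comp hlim2
  rw [ENNReal.zero_rpow_of_pos (by norm_num)] at hlim3
  refine tendsto_of_tendsto_of_tendsto_of_le_of_le' tendsto_const_nhds hlim3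
    (Eventually.of_forall fun _ => zero_le) (ev.mono fun t ht => ?_)
  have h1 := ENNReal.rpow_le_rpow (hle t ht.1) (by norm_num : (0 : ℝ) ≤ 1 / 2)
  rw [← ENNReal.rpow_natCast, ← ENNReal.rpow_mul] at h1
  simpa using h1

end

/-! ### Averaging the Navier-Stokes equations -/

section

variable {X : Type*} [MeasurableSpace X] {P : Measure X} {Ω : Set E3} {T ν : ℝ}
  {v₀ : E3 → X → E3} {f v : ℝ → E3 → X → E3} {π : ℝ → E3 → X → ℝ}

lemma turbulentStress_eq (P : Measure X) (v : ℝ → E3 → X → E3) (t : ℝ) :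
    turbulentStress P v t = stress P (v t) := rfl

/-- The bounds are taken on [t/2, (t+T)/2], a neighbourhood of t, so the same M and g also dominate
the time derivative at nearby times. Replacing g by |g| makes the weight nonnegative; M is
nonnegative since it bounds a norm at some point of Ω. -/
lemma exists_isRandomField (hΩ : IsOpen Ω) (hb : Bornology.IsBounded Ω) (hne : Ω.Nonempty)
    (hNS : ∀ ω, SolvesNavierStokes Ω T ν (fun x => v₀ x ω) (fun t x => f t x ω)
      (fun t x => v t x ω) (fun t x => π t x ω))
    (hmom : HasSecondMoments P Ω T v₀ v π) {t : ℝ} (ht : t ∈ Ioo 0 T) :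
    ∃ (M : X → ℝ) (g : E3 → ℝ), IsRandomField P Ω (v t) (π t) M g ∧
      ∀ᶠ τ in 𝓝 t, τ ∈ Ioo 0 T ∧
        ∀ x ∈ Ω, ∀ ω, ‖deriv (fun τ => v τ x ω) τ‖ ≤ M ω ^ 2 * g x := by
  obtain ⟨M, g, hM, hgc, hgi, hbd⟩ := hmom.bounds (t / 2) ((t + T) / 2) (by linarith [ht.1])
    (by linarith [ht.2])
  have htI : t ∈ Icc (t / 2) ((t + T) / 2) := ⟨by linarith [ht.1], by linarith [ht.2]⟩
  obtain ⟨x₁, hx₁⟩ := hne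
  have hM0 : ∀ ω, 0 ≤ M ω := fun ω => (norm_nonneg _).trans (hbd t htI x₁ hx₁ ω).1
  have hle : ∀ (c : ℝ) x, 0 ≤ c → c * g x ≤ c * |g x| := fun c x hc =>
    mul_le_mul_of_nonneg_left (le_abs_self _) hc
  refine ⟨M, fun x => |g x|, ?_, ?_⟩
  · exact
    { isOpen := hΩ
      bounded := hb
      memLp := hM
      nonneg := hM0
      g_nonneg := fun x => abs_nonneg _
      g_continuousOn := hgc.abs
      g_integrable := hgi.abs
      meas := fun x hx => (hmom.measurable_velocity t ht x hx).aestronglyMeasurable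
      meas_pressure := fun x hx => (hmom.measurable_pressure t ht x hx).aestronglyMeasurable
      contDiffOn := fun ω => (hNS ω).contDiffOn_velocity t ht
      continuousOn := fun ω => (hNS ω).continuousOn_velocity t ht
      contDiffOn_pressure := fun ω => by
        have h1 := (hNS ω).contDiffOn_pressure t ht
        have h2 : ContDiffOn ℝ 1 (fun x => v t x ω) Ω :=
          ((hNS ω).contDiffOn_velocity t ht).of_le one_le_two
        refine (h1.sub ((h2.norm_sq ℝ).div_const 2)).congr fun x _ => ?_
        simp
      eq_zero := fun ω x hx => (hNS ω).no_slip t ht x hx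
      le := fun x hx ω => (hbd t htI x hx ω).1
      fderiv_le := fun x hx ω => (hbd t htI x hx ω).2.1
      fderiv_fderiv_le := fun x hx ω => (hbd t htI x hx ω).2.2.1.trans (hle _ x (hM0 ω))
      pressure_le := fun x hx ω => (hbd t htI x hx ω).2.2.2.2.1.trans (hle _ x (sq_nonneg _))
      fderiv_pressure_le := fun x hx ω =>
        (hbd t htI x hx ω).2.2.2.2.2.trans (hle _ x (sq_nonneg _)) }
  · filter_upwards [Ioo_mem_nhds ht.1 ht.2,
      Icc_mem_nhds (a := t / 2) (b := (t + T) / 2) (by linarith [ht.1]) (by linarith [ht.2])]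
      with τ hτ hτI
    exact ⟨hτ, fun x hx ω => (hbd τ hτI x hx ω).2.2.2.1.trans (hle _ x (sq_nonneg _))⟩

/-- The mean velocity is differentiable in time, and the mean commutes with the time derivative. -/
lemma hasDerivAt_mean [IsProbabilityMeasure P] (hΩ : IsOpen Ω) (hb : Bornology.IsBounded Ω)
    (hne : Ω.Nonempty)
    (hNS : ∀ ω, SolvesNavierStokes Ω T ν (fun x => v₀ x ω) (fun t x => f t x ω)
      (fun t x => v t x ω) (fun t x => π t x ω))
    (hmom : HasSecondMoments P Ω T v₀ v π) {t : ℝ} (ht : t ∈ Ioo 0 T) {x : E3} (hx : x ∈ Ω) :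
    Integrable (fun ω => deriv (fun τ => v τ x ω) t) P ∧
      HasDerivAt (fun τ => mean P v τ x) (∫ ω, deriv (fun τ => v τ x ω) t ∂P) t := by
  obtain ⟨M, g, H, hd⟩ := exists_isRandomField hΩ hb hne hNS hmom ht
  refine hasDerivAt_integral_of_dominated_loc_of_deriv_le (F := fun τ ω => v τ x ω)
    (F' := fun τ ω => deriv (fun τ => v τ x ω) τ) (bound := fun ω => M ω ^ 2 * g x) hd ?_
    (H.velocity.integrable hx) ?_ (Eventually.of_forall fun ω τ hτ => hτ.2 x hx ω)
    (H.memLp.integrable_sq.mul_const _)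
    (Eventually.of_forall fun ω τ hτ => ((hNS ω).differentiable_time τ hτ.1 x hx).hasDerivAt)
  · exact (isOpen_Ioo.eventually_mem ht).mono fun τ hτ =>
      (hmom.measurable_velocity τ hτ x hx).aestronglyMeasurable
  · exact aestronglyMeasurable_fderiv_apply (h := fun τ ω => v τ x ω) isOpen_Ioo
      (fun τ hτ => (hmom.measurable_velocity τ hτ x hx).aestronglyMeasurable) ht
      (fun ω => (hNS ω).differentiable_time t ht x hx) 1

/-- No measurability or bound is assumed of the force: the momentum equation expresses it as a sum
of integrable terms, and taking means term by term gives the averaged equation with the stress still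
undecomposed. -/
lemma integrable_force_and_mean_momentum [IsProbabilityMeasure P] (hΩ : IsOpen Ω)
    (hb : Bornology.IsBounded Ω) (hne : Ω.Nonempty)
    (hNS : ∀ ω, SolvesNavierStokes Ω T ν (fun x => v₀ x ω) (fun t x => f t x ω)
      (fun t x => v t x ω) (fun t x => π t x ω))
    (hmom : HasSecondMoments P Ω T v₀ v π) {t : ℝ} (ht : t ∈ Ioo 0 T) {x : E3} (hx : x ∈ Ω) :
    Integrable (f t x) P ∧
      deriv (fun τ => mean P v τ x) t + (cross (curl (mean P v t) x) (mean P v t x)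
          + turbulentStress P v t x) - ν • Laplacian.laplacian (mean P v t) x
        + gradient (fun y => ∫ ω, (π t y ω + ‖v t y ω‖ ^ 2 / 2) ∂P) x = mean P f t x := by
  obtain ⟨M, g, H, -⟩ := exists_isRandomField hΩ hb hne hNS hmom ht
  obtain ⟨i1, hd⟩ := hasDerivAt_mean hΩ hb hne hNS hmom ht hx
  have i2 := H.convection_family.integrable hx
  have i3 : Integrable (fun ω => ν • Laplacian.laplacian (fun y => v t y ω) x) P :=
    (H.integrable_laplacian hx).smul ν
  have i4 := H.integrable_gradient_head hx
  have i12 : Integrable (fun ω => deriv (fun τ => v τ x ω) t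
      + cross (curl (fun y => v t y ω) x) (v t x ω)) P := i1.add i2
  have i123 : Integrable (fun ω => deriv (fun τ => v τ x ω) t
      + cross (curl (fun y => v t y ω) x) (v t x ω)
      - ν • Laplacian.laplacian (fun y => v t y ω) x) P := i12.sub i3
  have hf : f t x = fun ω => deriv (fun τ => v τ x ω) t
      + cross (curl (fun y => v t y ω) x) (v t x ω)
      - ν • Laplacian.laplacian (fun y => v t y ω) x
      + gradient (fun y => π t y ω + ‖v t y ω‖ ^ 2 / 2) x := by
    ext1 ω
    have := (hNS ω).momentum t ht x hx
    rw [← this, add_zero]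
  refine ⟨hf ▸ i123.add i4, ?_⟩
  have e1 : mean P f t x = ∫ ω, f t x ω ∂P := rfl
  rw [e1, hf, integral_add i123 i4, integral_sub i12 i3, integral_add i1 i2,
    H.integral_gradient_head hx, integral_smul, H.integral_laplacian hx, hd.deriv,
    turbulentStress_eq, H.stress_eq hx]
  congr 3
  exact add_sub_cancel _ _

end

end Reynolds

/-! ### The averaged system. -/

theorem mainTheorem3
    (Ω : Set Reynolds.E3) (hΩ_bounded : Bornology.IsBounded Ω) (hΩ_connected : IsConnected Ω)
    (hΩ_C1 : Reynolds.IsOfClassC1 Ω)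
    (T ν : ℝ) (hT : 0 < T) (hν : 0 ≤ ν)
    {X : Type*} [MeasurableSpace X] (P : Measure X) [IsProbabilityMeasure P]
    (v₀ : Reynolds.E3 → X → Reynolds.E3) (f v : ℝ → Reynolds.E3 → X → Reynolds.E3)
    (π : ℝ → Reynolds.E3 → X → ℝ)
    (hNS : ∀ ω, Reynolds.SolvesNavierStokes Ω T ν (fun x => v₀ x ω) (fun t x => f t x ω)
      (fun t x => v t x ω) (fun t x => π t x ω))
    (hmom : Reynolds.HasSecondMoments P Ω T v₀ v π) :
    -- the means that occur exist, and the mean vorticity is the vorticity of the mean velocity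
    (∀ t ∈ Ioo 0 T, ∀ x ∈ Ω,
      Integrable (v t x) P ∧ Integrable (Reynolds.vorticity v t x) P ∧
      Integrable (π t x) P ∧ Integrable (f t x) P ∧
      Integrable (fun ω => ‖Reynolds.fluct P v t x ω‖ ^ 2) P ∧
      Integrable (fun ω => Reynolds.cross (Reynolds.fluct P (Reynolds.vorticity v) t x ω)
        (Reynolds.fluct P v t x ω)) P ∧
      Reynolds.mean P (Reynolds.vorticity v) t x = Reynolds.curl (Reynolds.mean P v t) x) ∧
    -- the turbulent stress is regular enough for the potentials to be defined
    (∀ t ∈ Ioo 0 T,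
      ContinuousOn (Reynolds.turbulentStress P v t) (closure Ω) ∧
      ContDiffOn ℝ 1 (Reynolds.turbulentStress P v t) Ω ∧
      ∀ x ∈ Ω, Reynolds.PotentialsConverge Ω (Reynolds.turbulentStress P v t) x) ∧
    -- the averaged equations
    ∃ (a : ℝ → Reynolds.E3 → Reynolds.E3) (Φ : ℝ → Reynolds.E3 → ℝ),
      (∀ t ∈ Ioo 0 T, ∀ x ∈ Ω,
        a t x = Reynolds.vectorPotential Ω (Reynolds.turbulentStress P v t) x ∧
        Φ t x = Reynolds.scalarPotential Ω (Reynolds.turbulentStress P v t) x) ∧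
      (∀ t ∈ Ioo 0 T, ContDiffOn ℝ 1 (a t) Ω ∧ ContDiffOn ℝ 1 (Φ t) Ω) ∧
      Reynolds.SolvesRotational Ω T ν (fun x => ∫ ω, v₀ x ω ∂P) (Reynolds.mean P f)
        (fun t x => Reynolds.curl (a t) x) (Reynolds.mean P v)
        (fun t x => Reynolds.mean P π t x + ‖Reynolds.mean P v t x‖ ^ 2 / 2
          + Reynolds.turbulentEnergy P v t x - Φ t x) := by
  have hΩ := hΩ_C1.1
  have hne := hΩ_connected.nonempty
  have hF := fun t (ht : t ∈ Ioo 0 T) =>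
    Reynolds.exists_isRandomField hΩ hΩ_bounded hne hNS hmom ht
  have hpot : ∀ t ∈ Ioo 0 T, ∀ x ∈ Ω,
      Reynolds.curl (Reynolds.vectorPotential Ω (Reynolds.turbulentStress P v t)) x
        - gradient (Reynolds.scalarPotential Ω (Reynolds.turbulentStress P v t)) x
        = Reynolds.turbulentStress P v t x := fun t ht x hx => by
    obtain ⟨M, g, H, -⟩ := hF t ht
    exact Reynolds.curl_vectorPotential_sub_gradient_scalarPotential hΩ hΩ_bounded
      H.contDiffOn_stress H.continuousOn_stress (fun _ => H.stress_eq_zero)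
      H.integrableOn_fderiv_stress hx
  have hA : ∀ t ∈ Ioo 0 T,
      ContDiffOn ℝ 1 (Reynolds.vectorPotential Ω (Reynolds.turbulentStress P v t)) Ω :=
    fun t ht => by
      obtain ⟨M, g, H, -⟩ := hF t ht
      exact Reynolds.contDiffOn_vectorPotential hΩ H.contDiffOn_stress
        (fun _ => H.stress_eq_zero) H.integrableOn_fderiv_stress
  have hB : ∀ t ∈ Ioo 0 T,
      ContDiffOn ℝ 1 (Reynolds.scalarPotential Ω (Reynolds.turbulentStress P v t)) Ω :=
    fun t ht => by
      obtain ⟨M, g, H, -⟩ := hF t ht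
      exact Reynolds.contDiffOn_scalarPotential hΩ H.contDiffOn_stress
        (fun _ => H.stress_eq_zero) H.integrableOn_fderiv_stress
  -- The new pressure is the mean of π + |v|²/2 minus Φ. The equality holds on Ω, which suffices for
  -- regularity and, as Ω is open, for gradients.
  have hhead : ∀ t ∈ Ioo 0 T, EqOn (fun x => Reynolds.mean P π t x
      + ‖Reynolds.mean P v t x‖ ^ 2 / 2 + Reynolds.turbulentEnergy P v t x
      - Reynolds.scalarPotential Ω (Reynolds.turbulentStress P v t) x)
      (fun x => (∫ ω, (π t x ω + ‖v t x ω‖ ^ 2 / 2) ∂P)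
      - Reynolds.scalarPotential Ω (Reynolds.turbulentStress P v t) x) Ω := fun t ht x hx => by
    obtain ⟨M, g, H, -⟩ := hF t ht
    exact congrArg (· - _) (H.integral_head hx).symm
  refine ⟨fun t ht x hx => ?_, fun t ht => ?_,
    fun t => Reynolds.vectorPotential Ω (Reynolds.turbulentStress P v t),
    fun t => Reynolds.scalarPotential Ω (Reynolds.turbulentStress P v t),
    fun t _ x _ => ⟨rfl, rfl⟩, fun t ht => ⟨hA t ht, hB t ht⟩, ?_⟩
  · obtain ⟨M, g, H, -⟩ := hF t ht
    exact ⟨H.velocity.integrable hx, H.integrable_curl hx, H.integrable_pressure hx,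
      (Reynolds.integrable_force_and_mean_momentum hΩ hΩ_bounded hne hNS hmom ht hx).1,
      H.integrable_norm_sq_fluctuation hx, H.integrable_cross_fluctuation hx, H.integral_curl hx⟩
  · obtain ⟨M, g, H, -⟩ := hF t ht
    exact ⟨H.continuousOn_stress, H.contDiffOn_stress, fun x hx =>
      Reynolds.potentialsConverge hΩ H.contDiffOn_stress (fun _ => H.stress_eq_zero)
        H.integrableOn_fderiv_stress hx⟩
  · refine ⟨fun t ht x hx => ?_, fun t ht => ?_, fun t ht => ?_, fun t ht => ?_,
      fun t ht x hx => ?_, fun t ht x hx => ?_, fun t ht x hx => ?_, fun x hx => ?_, ?_⟩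
    · exact (Reynolds.hasDerivAt_mean hΩ hΩ_bounded hne hNS hmom ht hx).2.differentiableAt
    · obtain ⟨M, g, H, -⟩ := hF t ht
      exact H.contDiffOn_mean
    · obtain ⟨M, g, H, -⟩ := hF t ht
      exact H.continuousOn_mean
    · obtain ⟨M, g, H, -⟩ := hF t ht
      exact (H.head_family.contDiffOn_integral.sub (hB t ht)).congr (hhead t ht)
    · obtain ⟨M, g, H, -⟩ := hF t ht
      have hq : gradient (fun x => Reynolds.mean P π t x
          + ‖Reynolds.mean P v t x‖ ^ 2 / 2 + Reynolds.turbulentEnergy P v t x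
          - Reynolds.scalarPotential Ω (Reynolds.turbulentStress P v t) x) x
          = gradient (fun y => ∫ ω, (π t y ω + ‖v t y ω‖ ^ 2 / 2) ∂P) x
          - gradient (Reynolds.scalarPotential Ω (Reynolds.turbulentStress P v t)) x := by
        simp only [Reynolds.gradient_eq]
        rw [((hhead t ht).eventuallyEq_of_mem (hΩ.mem_nhds hx)).fderiv_eq, ← map_sub]
        congr 1
        exact fderiv_fun_sub (H.head_family.hasFDerivAt hx).differentiableAt
          (((hB t ht).differentiableOn one_ne_zero x hx).differentiableAt (hΩ.mem_nhds hx))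
      -- Replacing s by curl a − ∇Φ in the averaged momentum equation makes the two sides agree term
      -- by term.
      rw [hq, ← (Reynolds.integrable_force_and_mean_momentum hΩ hΩ_bounded hne hNS hmom ht hx).2,
        ← hpot t ht x hx]
      abel
    · obtain ⟨M, g, H, -⟩ := hF t ht
      have h : ∀ ω, Reynolds.div (fun y => v t y ω) x = 0 := fun ω =>
        (hNS ω).incompressible t ht x hx
      have h2 := H.integral_div hx
      simp only [h, integral_zero] at h2
      exact h2.symm
    · obtain ⟨M, g, H, -⟩ := hF t ht
      exact H.mean_eq_zero hx
    · exact integral_congr_ae (Eventually.of_forall fun ω => (hNS ω).initial x hx)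
    · obtain ⟨δ, hδ, M, hM, hb⟩ := hmom.energy_bound
      refine Reynolds.tendsto_eLpNorm_mean_sub hΩ hT hmom.measurable_initial
        hmom.measurable_velocity (fun t ht x hx => ?_) (fun t ht ω => ?_)
        (fun ω => (hNS ω).initial_attained) hδ hM hb
      · obtain ⟨M, g, H, -⟩ := hF t ht
        exact H.velocity.integrable hx
      · exact ((hNS ω).continuousOn_velocity t ht).mono subset_closure
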